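/- There are an absolute constant $C>0$ and numbers $0<\nu_c\le\sqrt c$ ($c=1,2,\dots$) such that the following holds. **Setting.** Let $n\ge1$, $B,\epsilon,\delta,\gamma>0$, and let $f_{\mathbf w}(\mathbf x)=W_n\phi(W_{n-1}\cdots\phi(W_1\mathbf x)\cdots)$ be an $n$-layer ReLU network with inputs in $\mathbb R^d$ and $d_y$ output scores, $\phi(t)=\max(t,0)$ coordinatewise, in which every layer (input and output included) has at most $h$ units. Let $\mathcal D$ be a probability distribution on $\{\mathbf x\in\mathbb R^d:\|\mathbf x\|_2\le B\}\times\{1,\dots,d_y\}$ and $\mathcal S=((\mathbf x_q,y_q))_{q\le m}$ a sample of $m$ independent draws from $\mathcal D$; $m_j$ is the number of $q$ with $y_q=j$ and $m_{min}=\min_j m_j$. **Adversarial data.** For a loss $\ell(z,y)$ of a score vector $z$ and a label $y$, an attack on $f_{\mathbf w}$ is a measurable map $(\mathbf x,y)\mapsto\mathbf x'$ with $\mathbf x'\in\arg\max_{\|\mathbf x''-\mathbf x\|_2\le\epsilon}\ell(f_{\mathbf w}(\mathbf x''),y)$ whenever $\|\mathbf x\|_2\le B$. It turns $\mathcal S$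 into $\mathcal S'=((\mathbf x_q',y_q))_q$, and $\mathcal D'$ is the law of $(\mathbf x',y)$ for $(\mathbf x,y)\sim\mathcal D$. A *margin loss* is a loss with $\ell(z,y)>\ell(z',y)$ whenever $z_y-\max_{i\ne y}z_i<z'_y-\max_{i\ne y}z'_i$. **Confusion matrices** ($d_y\times d_y$, zero diagonal). For $i\ne j$, $(\mathcal C_{\mathcal D'})_{ij}$ is the conditional probability, under $(\mathbf x',y)\sim\mathcal D'$ given $y=j$, that $f_{\mathbf w}(\mathbf x')[i]=\max_{i'}f_{\mathbf w}(\mathbf x')[i']$, where a tie between several wrong labels $i\neq j$ is given to the smallest one only (a tie with $j$ counts as an error). So the $j$-th column sum is $\mathbb P(\max_{i\ne j}f_{\mathbf w}(\mathbf x')[i]\ge f_{\mathbf w}(\mathbf x')[j]\mid y=j)$, and $\|\mathcal C_{\mathcal D'}\|_1$ (maximal absolute column sum) is the worst-class robust error. For $i\neq j$, $(\mathcal C_{\mathcal S',\gamma})_{ij}$ is the fraction, among the $m_j$ examples of $\mathcal S'$ with label $j$, of those with $f_{\mathbf w}(\mathbf x')[j]\le\gamma+f_{\mathbf w}(\mathbf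 x')[i]$ and $\arg\max_{i'\ne j}f_{\mathbf w}(\mathbf x')[i']=i$ (ties to the smallest index). $\|\cdot\|_2$ is the spectral norm and $\|\cdot\|_F$ the Frobenius norm. **Bound.** Put $$\Phi'(f_{\mathbf w})=(B+\epsilon)^2n^2h\ln(nh)\prod_{l=1}^n\|W_l\|_2^2\sum_{l=1}^n\frac{\|W_l\|_F^2}{\|W_l\|_2^2}$$ (read as $0$ if some $W_l=0$), and $\nu=\nu_{d_y}$. Consider the event that, if $m_{min}>8d_y$, then both $$\|\mathcal C_{\mathcal D'}\|_1\le\nu\|\mathcal C_{\mathcal S',\gamma}\|_2+C\sqrt{\frac{\nu^2d_y}{m_{min}-8d_y}\Big[\frac{\Phi'(f_{\mathbf w})}{\gamma^2}+\ln\frac{n\,m_{min}}{\delta}\Big]}$$ and $$\|\mathcal C_{\mathcal D'}\|_1\le\nu\|\mathcal C_{\mathcal S',\gamma}\|_2+C\max(1,\gamma)\sqrt{\frac{\nu^2d_y}{(m_{min}-8d_y)\gamma^2}\Big[\Phi'(f_{\mathbf w})+\ln\frac{n\,m_{min}}{\delta}\Big]}.$$ 1. For every loss $\ell$, every fixed $\mathbf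 w$ and every attack on $f_{\mathbf w}$, this event has probability at least $1-\delta$ over the draw of $\mathcal S$. 2. With probability at least $1-\delta$ over the draw of $\mathcal S$, it holds simultaneously for all weights $\mathbf w$ (which may depend on $\mathcal S$), all margin losses and all attacks on $f_{\mathbf w}$. -/

import Mathlib

open MeasureTheory ProbabilityTheory
open scoped Matrix

noncomputable section

namespace RobustConfusion

/-! ### ReLU networks -/

/-- Weights of an `n`-layer network. The layer widths are `k 0` (input dimension), ..., `k n`
(number of outputs, that is, of classes); the `l`-th matrix (counted from `0`) maps layer `l`
to layer `l + 1`. -/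
abbrev Weights (n : ℕ) (k : ℕ → ℕ) : Type :=
  (l : Fin n) → Matrix (Fin (k (l + 1))) (Fin (k l)) ℝ

/-- The ReLU activation function, coordinatewise. -/
def relu {ι : Type*} (v : ι → ℝ) : ι → ℝ := fun i => max (v i) 0

/-- The value at layer `l` before activation: `x`, then `W₁ x`, then `W₂ φ(W₁ x)`, and so on. -/
def layer {n : ℕ} {k : ℕ → ℕ} (W : Weights n k) (x : EuclideanSpace ℝ (Fin (k 0))) :
    (l : ℕ) → l ≤ n → Fin (k l) → ℝ
  | 0, _ => fun i => x i
  | 1, h => W ⟨0, h⟩ *ᵥ fun i => x i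
  | l + 2, h => W ⟨l + 1, h⟩ *ᵥ relu (layer W x (l + 1) (Nat.le_of_succ_le h))

/-- The network `f_w(x) = W_n φ(W_{n-1} ... φ(W_1 x) ...)`, with one score for each class. -/
def net {n : ℕ} {k : ℕ → ℕ} (W : Weights n k) (x : EuclideanSpace ℝ (Fin (k 0))) :
    Fin (k n) → ℝ :=
  layer W x n le_rfl

/-! ### Matrix norms -/

open scoped Matrix.Norms.L2Operator in
/-- Spectral norm (largest singular value): the `ℓ²`-operator norm. -/
def specNorm {p q : ℕ} (M : Matrix (Fin p) (Fin q) ℝ) : ℝ := ‖M‖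

/-- The square of the Frobenius norm. -/
def frobSq {p q : ℕ} (M : Matrix (Fin p) (Fin q) ℝ) : ℝ := ∑ i, ∑ j, M i j ^ 2

/-- The `ℓ¹` matrix norm: the maximal absolute column sum. -/
def colNorm {p q : ℕ} (M : Matrix (Fin p) (Fin q) ℝ) : ℝ := ⨆ j, ∑ i, |M i j|

/-- `Φ'(f_w) = (B+ε)² n² h ln(nh) ∏ ‖W_l‖₂² ∑ ‖W_l‖_F² / ‖W_l‖₂²`. -/
def complexity {n : ℕ} {k : ℕ → ℕ} (h : ℕ) (B ε : ℝ) (W : Weights n k) : ℝ :=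
  (B + ε) ^ 2 * (n : ℝ) ^ 2 * h * Real.log (n * h) *
    (∏ l, specNorm (W l) ^ 2) * ∑ l, frobSq (W l) / specNorm (W l) ^ 2

/-! ### Confusion matrices -/

/-- With scores `z` and true label `j`, the wrong label `i` is output: its score is maximal.
Ties with `j` count as errors; ties between wrong labels go to the smallest one, so that an error
is counted in exactly one place of the `j`-th column. -/
def Predicts {c : ℕ} (z : Fin c → ℝ) (j i : Fin c) : Prop :=
  (∀ i', z i' ≤ z i) ∧ ∀ i', i' ≠ j → i' < i → z i' < z i

/-- `argmax_{i' ≠ j} z[i'] = i`, with ties going to the smallest index. -/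
def IsArgmaxWrong {c : ℕ} (z : Fin c → ℝ) (j i : Fin c) : Prop :=
  (i ≠ j) ∧ (∀ i', i' ≠ j → z i' ≤ z i) ∧ ∀ i', i' ≠ j → i' < i → z i' < z i

/-- The confusion matrix of the score function `f` under the distribution `D`: the `(i, j)` entry
is, for `i ≠ j`, the conditional probability that `i` is output, given that the label is `j`. -/
def trueConfusion {X : Type*} [MeasurableSpace X] {c : ℕ} (f : X → Fin c → ℝ)
    (D : Measure (X × Fin c)) : Matrix (Fin c) (Fin c) ℝ :=
  Matrix.of fun i j =>
    if i = j then 0 else (cond D {p | p.2 = j}).real {p | Predicts (f p.1) j i}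

/-- The number `m_j` of samples with label `j`. -/
def classCount {X : Type*} {m c : ℕ} (S : Fin m → X × Fin c) (j : Fin c) : ℕ :=
  (Finset.univ.filter fun q => (S q).2 = j).card

/-- `m_min`: the least number of samples in one class. -/
def minClassCount {X : Type*} {m c : ℕ} (S : Fin m → X × Fin c) : ℕ := ⨅ j, classCount S j

open Classical in
/-- The empirical confusion matrix with margin `γ` on the sample `S`. -/
def marginConfusion {X : Type*} {m c : ℕ} (γ : ℝ) (f : X → Fin c → ℝ) (S : Fin m → X × Fin c) :
    Matrix (Fin c) (Fin c) ℝ :=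
  Matrix.of fun i j =>
    if i = j then 0 else
      ∑ q, (1 / (classCount S j : ℝ)) *
        (if f (S q).1 (S q).2 ≤ γ + f (S q).1 i ∧ (S q).2 = j ∧
          IsArgmaxWrong (f (S q).1) (S q).2 i then 1 else 0)

/-! ### Adversarial examples -/

/-- `A` maps each example `(x, y)` with `‖x‖ ≤ B` to an adversarial example `x'`: a maximizer of
the loss `ℓ (f x') y` over the closed `ℓ²`-ball of radius `ε` around `x`. -/
structure IsAttack {d c : ℕ} (B ε : ℝ) (ℓ : (Fin c → ℝ) → Fin c → ℝ)
    (f : EuclideanSpace ℝ (Fin d) → Fin c → ℝ)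
    (A : EuclideanSpace ℝ (Fin d) × Fin c → EuclideanSpace ℝ (Fin d)) : Prop where
  measurable : Measurable A
  mem_ball : ∀ x y, ‖x‖ ≤ B → ‖A (x, y) - x‖ ≤ ε
  isMax : ∀ x y, ‖x‖ ≤ B → ∀ x', ‖x' - x‖ ≤ ε → ℓ (f x') y ≤ ℓ (f (A (x, y))) y

/-- The adversarial data distribution `D'`: the law of `(x', y)` for `(x, y)` drawn from `D`. -/
def advMeasure {X : Type*} [MeasurableSpace X] {c : ℕ} (A : X × Fin c → X)
    (D : Measure (X × Fin c)) : Measure (X × Fin c) :=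
  D.map fun p => (A p, p.2)

/-- The adversarial training set `S'`. -/
def advSample {X : Type*} {m c : ℕ} (A : X × Fin c → X) (S : Fin m → X × Fin c) :
    Fin m → X × Fin c :=
  fun q => (A (S q), (S q).2)

/-- The margin `z[y] - max_{i ≠ y} z[i]` of the scores `z` at the label `y`. -/
def margin {c : ℕ} (z : Fin c → ℝ) (y : Fin c) : ℝ := z y - ⨆ i : {i : Fin c // i ≠ y}, z i

/-- A loss that is larger whenever the margin is smaller. -/
def IsMarginLoss {c : ℕ} (ℓ : (Fin c → ℝ) → Fin c → ℝ) : Prop :=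
  ∀ z z' y, margin z y < margin z' y → ℓ z' y < ℓ z y

/-! ### The bound -/

/-- The bound for the sample `S`, the weights `W` and the attack `A`, with the constant `C` in the
place of the `O`-symbol: first with only the complexity term divided by `γ²`, then with both
terms divided by `γ²` (and the same constant if `γ ≤ 1`). -/
def RobustBound {n m : ℕ} {k : ℕ → ℕ} (C ν : ℝ) (h : ℕ) (B ε δ γ : ℝ)
    (D : Measure (EuclideanSpace ℝ (Fin (k 0)) × Fin (k n)))
    (S : Fin m → EuclideanSpace ℝ (Fin (k 0)) × Fin (k n)) (W : Weights n k)
    (A : EuclideanSpace ℝ (Fin (k 0)) × Fin (k n) → EuclideanSpace ℝ (Fin (k 0))) : Prop :=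
  colNorm (trueConfusion (net W) (advMeasure A D)) ≤
      ν * specNorm (marginConfusion γ (net W) (advSample A S)) +
        C * √(ν ^ 2 * k n / ((minClassCount S : ℝ) - 8 * k n) *
          (complexity h B ε W / γ ^ 2 + Real.log (n * minClassCount S / δ))) ∧
    colNorm (trueConfusion (net W) (advMeasure A D)) ≤
      ν * specNorm (marginConfusion γ (net W) (advSample A S)) +
        C * max 1 γ * √(ν ^ 2 * k n / (((minClassCount S : ℝ) - 8 * k n) * γ ^ 2) *
          (complexity h B ε W + Real.log (n * minClassCount S / δ)))

end RobustConfusion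

end

/-!
Every network is within `γ / 4` of a network from a countable family: after normalization, each
layer is close in spectral norm to a sum of at most `‖W‖_F² / (‖W‖₂² η²)` rank-one matrices (the
directions with singular value above `η`), and their entries can be rounded to a grid. Encoding the
resolution, the ranks and the grid points gives a prefix code of length `O(Φ' / γ²)`. By Hoeffding's
inequality, applied to the samples of one class, and a union bound weighted by the code (Kraft's
inequality), the frequencies of the events that some perturbation of `x` has margin at most `γ / 2`
are controlled for all codes and classes at once. As a margin loss makes the attack minimize the
margin, this event for the code lies between the events that the attacked network has margin at
most `0` and at most `γ`. A column sum is at most `√c` times the spectral norm, whence `ν = √c`.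
For a single network and attack no approximation is needed.
-/

noncomputable section

namespace RobustConfusion

/-! ### Low-rank approximation of matrices -/

section Matrices

open scoped Matrix.Norms.L2Operator
open WithLp (toLp)

variable {m n : Type*} [Fintype m] [Fintype n]

/-- Sums of `t` rank-one matrices `u vᵀ` with `‖u‖ ≤ a` and `‖v‖ ≤ 1`: the matrices of rank at
most `t`, with a control of the size of the factors. -/
def rankOneSums (m n : Type*) [Fintype m] [Fintype n] (t : ℕ) (a : ℝ) : Set (Matrix m n ℝ) :=
  {L | ∃ (u : Fin t → m → ℝ) (v : Fin t → n → ℝ), (∀ i, ‖toLp 2 (u i)‖ ≤ a) ∧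
    (∀ i, ‖toLp 2 (v i)‖ ≤ 1) ∧ L = ∑ i, Matrix.vecMulVec (u i) (v i)}

lemma zero_mem_rankOneSums (t : ℕ) {a : ℝ} (ha : 0 ≤ a) : 0 ∈ rankOneSums m n t a :=
  ⟨0, 0, by simp [ha], by simp, by simp⟩

lemma vecMulVec_add_mem_rankOneSums {t : ℕ} {a : ℝ} {u : m → ℝ} {v : n → ℝ}
    {L : Matrix m n ℝ} (hu : ‖toLp 2 u‖ ≤ a) (hv : ‖toLp 2 v‖ ≤ 1)
    (hL : L ∈ rankOneSums m n t a) : Matrix.vecMulVec u v + L ∈ rankOneSums m n (t + 1) a := by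
  obtain ⟨us, vs, hus, hvs, rfl⟩ := hL
  refine ⟨Fin.cons u us, Fin.cons v vs, Fin.cases hu hus, Fin.cases hv hvs, ?_⟩
  simp [Fin.sum_univ_succ]

lemma rankOneSums_mono {t : ℕ} {a b : ℝ} (hab : a ≤ b) :
    rankOneSums m n t a ⊆ rankOneSums m n t b := by
  rintro L ⟨u, v, hu, hv, rfl⟩
  exact ⟨u, v, fun i => (hu i).trans hab, hv, rfl⟩

lemma sum_sq_sub_vecMulVec_mulVec (M : Matrix m n ℝ) {v : n → ℝ} (hv : ‖toLp 2 v‖ = 1) :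
    ∑ i, ∑ j, (M - Matrix.vecMulVec (M *ᵥ v) v) i j ^ 2 =
      ∑ i, ∑ j, M i j ^ 2 - ‖toLp 2 (M *ᵥ v)‖ ^ 2 := by
  have hv2 : ∑ j, v j ^ 2 = 1 := by
    simpa [hv] using (EuclideanSpace.real_norm_sq_eq (toLp 2 v)).symm
  rw [EuclideanSpace.real_norm_sq_eq, ← Finset.sum_sub_distrib]
  refine Finset.sum_congr rfl fun i _ => ?_
  have hMv : ∑ j, M i j * v j = (M *ᵥ v) i := rfl
  calc ∑ j, (M - Matrix.vecMulVec (M *ᵥ v) v) i j ^ 2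
      = ∑ j, (M i j ^ 2 - 2 * (M *ᵥ v) i * (M i j * v j) + (M *ᵥ v) i ^ 2 * v j ^ 2) := by
        refine Finset.sum_congr rfl fun j _ => ?_
        rw [Matrix.sub_apply, Matrix.vecMulVec_apply]
        ring
    _ = ∑ j, M i j ^ 2 - (M *ᵥ v) i ^ 2 := by
        rw [Finset.sum_add_distrib, Finset.sum_sub_distrib, ← Finset.mul_sum, ← Finset.mul_sum,
          hv2, hMv]
        ring

variable [DecidableEq n]

lemma l2_opNorm_le_of_mulVec {M : Matrix m n ℝ} {a : ℝ} (ha : 0 ≤ a)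
    (h : ∀ v, ‖toLp 2 (M *ᵥ v)‖ ≤ a * ‖toLp 2 v‖) : ‖M‖ ≤ a := by
  rw [Matrix.l2_opNorm_def]
  exact ContinuousLinearMap.opNorm_le_bound _ ha fun x => h x.ofLp

lemma l2_opNorm_sq_le_sum_sq (M : Matrix m n ℝ) : ‖M‖ ^ 2 ≤ ∑ i, ∑ j, M i j ^ 2 := by
  have hM : 0 ≤ ∑ i, ∑ j, M i j ^ 2 := by positivity
  refine (Real.le_sqrt (norm_nonneg _) hM).1 <|
    l2_opNorm_le_of_mulVec (Real.sqrt_nonneg _) fun v => ?_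
  refine le_of_sq_le_sq ?_ (by positivity)
  rw [mul_pow, Real.sq_sqrt hM, EuclideanSpace.real_norm_sq_eq, EuclideanSpace.real_norm_sq_eq,
    Finset.sum_mul]
  exact Finset.sum_le_sum fun i _ => Finset.sum_mul_sq_le_sq_mul_sq _ (M i) v

lemma norm_toLp_col_le (M : Matrix m n ℝ) (j : n) : ‖toLp 2 (M.col j)‖ ≤ ‖M‖ := by
  simpa using M.l2_opNorm_mulVec (toLp 2 (Pi.single j 1))

lemma l2_opNorm_le_of_abs_le {M : Matrix m n ℝ} {a : ℝ} (ha : 0 ≤ a) (h : ∀ i j, |M i j| ≤ a) :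
    ‖M‖ ≤ √(Fintype.card m * Fintype.card n) * a := by
  refine le_of_sq_le_sq ((l2_opNorm_sq_le_sum_sq M).trans ?_) (by positivity)
  calc ∑ i, ∑ j, M i j ^ 2 ≤ ∑ _i : m, ∑ _j : n, a ^ 2 :=
        Finset.sum_le_sum fun i _ => Finset.sum_le_sum fun j _ =>
          sq_le_sq.2 ((h i j).trans (le_abs_self a))
    _ = (√(Fintype.card m * Fintype.card n) * a) ^ 2 := by
        rw [mul_pow, Real.sq_sqrt (by positivity)]
        simp [mul_assoc]

lemma sum_abs_col_le (M : Matrix m n ℝ) (j : n) :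
    ∑ i, |M i j| ≤ √(Fintype.card m) * ‖M‖ := by
  calc ∑ i, |M i j| = ∑ i, 1 * |M i j| := by simp only [one_mul]
    _ ≤ √(∑ _i : m, (1 : ℝ) ^ 2) * √(∑ i, |M i j| ^ 2) := Real.sum_mul_le_sqrt_mul_sqrt _ _ _
    _ = √(Fintype.card m) * ‖toLp 2 (M.col j)‖ := by simp [EuclideanSpace.norm_eq]
    _ ≤ √(Fintype.card m) * ‖M‖ := by gcongr; exact norm_toLp_col_le M j

lemma mem_rankOneSums_card (M : Matrix m n ℝ) : M ∈ rankOneSums m n (Fintype.card n) ‖M‖ := by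
  let e := (Fintype.equivFin n).symm
  refine ⟨fun i => M.col (e i), fun i => Pi.single (e i) 1, fun i => norm_toLp_col_le M _,
    fun i => by simp, ?_⟩
  rw [Equiv.sum_comp e fun j => Matrix.vecMulVec (M.col j) (Pi.single j 1)]
  ext a b
  simp [Matrix.sum_apply, Matrix.vecMulVec_apply, Pi.single_apply]

lemma l2_opNorm_sub_vecMulVec_mulVec_le (M : Matrix m n ℝ) {v : n → ℝ} (hv : ‖toLp 2 v‖ = 1) :
    ‖M - Matrix.vecMulVec (M *ᵥ v) v‖ ≤ ‖M‖ := by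
  refine l2_opNorm_le_of_mulVec (norm_nonneg _) fun w => ?_
  have hproj : (M - Matrix.vecMulVec (M *ᵥ v) v) *ᵥ w = M *ᵥ (w - (v ⬝ᵥ w) • v) := by
    simp [Matrix.sub_mulVec, Matrix.vecMulVec_mulVec, Matrix.mulVec_sub, Matrix.mulVec_smul]
  have hle : ‖toLp 2 (w - (v ⬝ᵥ w) • v)‖ ≤ ‖toLp 2 w‖ := by
    refine le_of_sq_le_sq ?_ (norm_nonneg _)
    rw [WithLp.toLp_sub, WithLp.toLp_smul, norm_sub_sq_real, norm_smul, hv, real_inner_smul_right,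
      EuclideanSpace.inner_toLp_toLp, star_trivial, mul_one, Real.norm_eq_abs, sq_abs]
    nlinarith [sq_nonneg (v ⬝ᵥ w)]
  rw [hproj]
  exact (M.l2_opNorm_mulVec (toLp 2 _)).trans (by gcongr)

lemma exists_unit_le_norm_mulVec {M : Matrix m n ℝ} {e : ℝ} (he : 0 ≤ e) (hM : e < ‖M‖) :
    ∃ v : n → ℝ, ‖toLp 2 v‖ = 1 ∧ e ≤ ‖toLp 2 (M *ᵥ v)‖ := by
  obtain ⟨w, hw⟩ : ∃ w, e * ‖toLp 2 w‖ < ‖toLp 2 (M *ᵥ w)‖ := by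
    by_contra! hc
    exact hM.not_ge (l2_opNorm_le_of_mulVec he hc)
  have hw0 : 0 < ‖toLp 2 w‖ := by
    refine norm_pos_iff.2 fun h0 => ?_
    simp [(WithLp.toLp_eq_zero 2).1 h0] at hw
  refine ⟨‖toLp 2 w‖⁻¹ • w, ?_, ?_⟩
  · rw [WithLp.toLp_smul, norm_smul, norm_inv, norm_norm, inv_mul_cancel₀ hw0.ne']
  · rw [Matrix.mulVec_smul, WithLp.toLp_smul, norm_smul, norm_inv, norm_norm, inv_mul_eq_div,
      le_div_iff₀ hw0]
    exact hw.le

-- As long as the spectral norm exceeds `e`, projecting out a direction on which it is attained up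
-- to `e` lowers the squared Frobenius norm by `e ^ 2`; so this can happen at most `t` times.
lemma exists_rankOneSums_norm_sub_le {e : ℝ} (he : 0 ≤ e) {t : ℕ} {M : Matrix m n ℝ}
    (hM : ∑ i, ∑ j, M i j ^ 2 ≤ t * e ^ 2) : ∃ L ∈ rankOneSums m n t ‖M‖, ‖M - L‖ ≤ e := by
  induction t generalizing M with
  | zero =>
    refine ⟨0, zero_mem_rankOneSums 0 (norm_nonneg M), ?_⟩
    have hM0 : ‖M‖ ^ 2 ≤ 0 := by simpa using (l2_opNorm_sq_le_sum_sq M).trans hM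
    simpa [pow_eq_zero_iff two_ne_zero |>.1 (hM0.antisymm (sq_nonneg _))] using he
  | succ t ih =>
    rcases le_or_gt ‖M‖ e with hs | hs
    · exact ⟨0, zero_mem_rankOneSums _ (norm_nonneg M), by simpa using hs⟩
    obtain ⟨v, hv, hMv⟩ := exists_unit_le_norm_mulVec he hs
    obtain ⟨L, hL, hLe⟩ := ih (M := M - Matrix.vecMulVec (M *ᵥ v) v) <| by
      rw [sum_sq_sub_vecMulVec_mulVec M hv]
      push_cast at hM
      linarith [pow_le_pow_left₀ he hMv 2]
    refine ⟨Matrix.vecMulVec (M *ᵥ v) v + L, vecMulVec_add_mem_rankOneSums ?_ hv.le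
      (rankOneSums_mono (l2_opNorm_sub_vecMulVec_mulVec_le M hv) hL), by rwa [← sub_sub]⟩
    simpa [hv] using M.l2_opNorm_mulVec (toLp 2 v)

/-! ### Finite nets of matrices -/

/-- The equally spaced points `-1, -1 + 1 / N, …, 1` of `[-1, 1]`. -/
def gridPoint (N : ℕ) (i : Fin (2 * N + 1)) : ℝ := (i : ℝ) / N - 1

lemma abs_gridPoint_le_one {N : ℕ} (i : Fin (2 * N + 1)) : |gridPoint N i| ≤ 1 := by
  have hi : (i : ℝ) ≤ 2 * N := by exact_mod_cast Nat.lt_succ_iff.1 i.2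
  have h0 : (0 : ℝ) ≤ i / N := by positivity
  have h2 : (i : ℝ) / N ≤ 2 := div_le_of_le_mul₀ (by positivity) zero_le_two hi
  exact abs_le.2 ⟨by unfold gridPoint; linarith, by unfold gridPoint; linarith⟩

lemma exists_abs_sub_gridPoint_le {N : ℕ} (hN : 0 < N) {x : ℝ} (hx : |x| ≤ 1) :
    ∃ i, |x - gridPoint N i| ≤ 1 / N := by
  have hN' : (0 : ℝ) < N := by exact_mod_cast hN
  obtain ⟨h1, h2⟩ := abs_le.1 hx
  have h0 : 0 ≤ (x + 1) * N := mul_nonneg (by linarith) hN'.le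
  have hlt : ⌊(x + 1) * N⌋₊ < 2 * N + 1 := by
    refine Nat.lt_succ_of_le (Nat.floor_le_of_le ?_)
    push_cast
    gcongr
    linarith
  refine ⟨⟨⌊(x + 1) * N⌋₊, hlt⟩, ?_⟩
  have hround : x - gridPoint N ⟨⌊(x + 1) * N⌋₊, hlt⟩ =
      ((x + 1) * N - ⌊(x + 1) * N⌋₊) / N := by
    simp only [gridPoint]
    field_simp
    ring
  rw [hround, abs_of_nonneg (div_nonneg (sub_nonneg.2 (Nat.floor_le h0)) hN'.le)]
  gcongr
  linarith [Nat.lt_floor_add_one ((x + 1) * N)]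

/-- Codes for the sums of `t` rank-one matrices whose factors have all their entries on the grid
`gridPoint N`. -/
abbrev MatrixCode (m n : Type*) (N t : ℕ) : Type _ :=
  (Fin t → m → Fin (2 * N + 1)) × (Fin t → n → Fin (2 * N + 1))

/-- The matrix described by a code. -/
def MatrixCode.toMatrix {m n : Type*} {N t : ℕ} (c : MatrixCode m n N t) : Matrix m n ℝ :=
  ∑ i, Matrix.vecMulVec (fun a => gridPoint N (c.1 i a)) fun b => gridPoint N (c.2 i b)

lemma card_matrixCode (m n : Type*) [Fintype m] [Fintype n] (N t : ℕ) :
    Nat.card (MatrixCode m n N t) =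
      (2 * N + 1) ^ ((Fintype.card m + Fintype.card n) * t) := by
  simp [Nat.card_prod, Nat.card_fun, ← pow_mul, ← pow_add, add_mul]

lemma abs_mul_sub_mul_le {x y x' y' e : ℝ} (hy : |y| ≤ 1) (hx' : |x'| ≤ 1)
    (hx : |x - x'| ≤ e) (hy' : |y - y'| ≤ e) : |x * y - x' * y'| ≤ 2 * e := by
  calc |x * y - x' * y'| = |(x - x') * y + x' * (y - y')| := by ring_nf
    _ ≤ |x - x'| * |y| + |x'| * |y - y'| := by
        simpa only [abs_mul] using abs_add_le ((x - x') * y) (x' * (y - y'))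
    _ ≤ e * 1 + 1 * e := by
        gcongr
        exact (abs_nonneg _).trans hx
    _ = 2 * e := by ring

lemma exists_matrixCode_norm_sub_le {N t : ℕ} (hN : 0 < N) {L : Matrix m n ℝ}
    (hL : L ∈ rankOneSums m n t 1) :
    ∃ c : MatrixCode m n N t,
      ‖L - c.toMatrix‖ ≤ √(Fintype.card m * Fintype.card n) * (t * (2 * (1 / N))) := by
  obtain ⟨u, v, hu, hv, rfl⟩ := hL
  have hu' i a : |u i a| ≤ 1 := (PiLp.norm_apply_le (toLp 2 (u i)) a).trans (hu i)
  have hv' i b : |v i b| ≤ 1 := (PiLp.norm_apply_le (toLp 2 (v i)) b).trans (hv i)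
  choose cu hcu using fun i a => exists_abs_sub_gridPoint_le hN (hu' i a)
  choose cv hcv using fun i b => exists_abs_sub_gridPoint_le hN (hv' i b)
  refine ⟨(cu, cv), l2_opNorm_le_of_abs_le (by positivity) fun a b => ?_⟩
  calc |(∑ i, Matrix.vecMulVec (u i) (v i) - MatrixCode.toMatrix (cu, cv)) a b|
      = |∑ i, (u i a * v i b - gridPoint N (cu i a) * gridPoint N (cv i b))| := by
        simp [MatrixCode.toMatrix, Matrix.sum_apply, Matrix.vecMulVec_apply]
    _ ≤ ∑ i : Fin t, |u i a * v i b - gridPoint N (cu i a) * gridPoint N (cv i b)| :=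
        Finset.abs_sum_le_sum_abs _ _
    _ ≤ ∑ _i : Fin t, 2 * (1 / N : ℝ) := Finset.sum_le_sum fun i _ =>
        abs_mul_sub_mul_le (hv' i b) (abs_gridPoint_le_one _) (hcu i a) (hcv i b)
    _ = t * (2 * (1 / N)) := by simp

lemma exists_matrixCode_of_norm_le_one {h N : ℕ} (hm : Fintype.card m ≤ h)
    (hn : Fintype.card n ≤ h) (hN : 0 < N) {e : ℝ} (he : 0 < e) {M : Matrix m n ℝ}
    (hM : ‖M‖ ≤ 1) :
    ∃ t ≤ h, (t : ℝ) ≤ (∑ i, ∑ j, M i j ^ 2) / e ^ 2 + 1 ∧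
      ∃ c : MatrixCode m n N t, ‖M - c.toMatrix‖ ≤ e + 2 * h ^ 2 / N := by
  set s : ℕ := ⌈(∑ i, ∑ j, M i j ^ 2) / e ^ 2⌉₊
  have hs : (s : ℝ) ≤ (∑ i, ∑ j, M i j ^ 2) / e ^ 2 + 1 := (Nat.ceil_lt_add_one (by positivity)).le
  obtain ⟨t, htn, hts, L, hL, hLM⟩ : ∃ t ≤ Fintype.card n, t ≤ s ∧
      ∃ L ∈ rankOneSums m n t ‖M‖, ‖M - L‖ ≤ e := by
    rcases le_total (Fintype.card n) s with hns | hsn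
    · exact ⟨_, le_rfl, hns, M, mem_rankOneSums_card M, by simpa using he.le⟩
    · exact ⟨s, hsn, le_rfl, exists_rankOneSums_norm_sub_le he.le
        ((div_le_iff₀ (by positivity)).1 (Nat.le_ceil _))⟩
  obtain ⟨c, hc⟩ := exists_matrixCode_norm_sub_le hN (rankOneSums_mono hM hL)
  refine ⟨t, htn.trans hn, (Nat.cast_le.2 hts).trans hs, c, ?_⟩
  calc ‖M - c.toMatrix‖ ≤ ‖M - L‖ + ‖L - c.toMatrix‖ := norm_sub_le_norm_sub_add_norm_sub _ _ _
    _ ≤ e + √(h * h) * (h * (2 * (1 / N))) := by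
        refine add_le_add hLM (hc.trans ?_)
        gcongr
        exact htn.trans hn
    _ = e + 2 * h ^ 2 / N := by
        rw [Real.sqrt_mul_self (by positivity)]
        ring

end Matrices

/-! ### Perturbation of ReLU networks -/

section Networks

open scoped Matrix.Norms.L2Operator
open WithLp (toLp)

lemma norm_toLp_relu_sub_le {ι : Type*} [Fintype ι] (v w : ι → ℝ) :
    ‖toLp 2 (relu v - relu w)‖ ≤ ‖toLp 2 (v - w)‖ := by
  simp only [EuclideanSpace.norm_eq]
  gcongr with i
  exact abs_max_sub_max_le_abs (v i) (w i) 0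

lemma relu_smul {ι : Type*} {a : ℝ} (ha : 0 ≤ a) (v : ι → ℝ) : relu (a • v) = a • relu v := by
  ext i
  simp [relu, mul_max_of_nonneg _ _ ha]

lemma continuous_relu {ι : Type*} : Continuous (relu : (ι → ℝ) → ι → ℝ) :=
  continuous_pi fun i => (continuous_apply i).max continuous_const

/-- The activation applied to layer `l`: none to the input, `relu` to the hidden layers. With it,
`layer` satisfies a recursion without a special first step. -/
def activation {ι : Type*} : ℕ → (ι → ℝ) → ι → ℝ
  | 0, v => v
  | _ + 1, v => relu v

lemma norm_toLp_activation_sub_le {ι : Type*} [Fintype ι] (l : ℕ) (v w : ι → ℝ) :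
    ‖toLp 2 (activation l v - activation l w)‖ ≤ ‖toLp 2 (v - w)‖ := by
  cases l with
  | zero => exact le_rfl
  | succ l => exact norm_toLp_relu_sub_le v w

lemma activation_smul {ι : Type*} {a : ℝ} (ha : 0 ≤ a) (l : ℕ) (v : ι → ℝ) :
    activation l (a • v) = a • activation l v := by
  cases l with
  | zero => rfl
  | succ l => exact relu_smul ha v

lemma norm_toLp_activation_le {ι : Type*} [Fintype ι] (l : ℕ) (v : ι → ℝ) :
    ‖toLp 2 (activation l v)‖ ≤ ‖toLp 2 v‖ := by
  have hzero : activation l (0 : ι → ℝ) = 0 := by simpa using activation_smul le_rfl l (0 : ι → ℝ)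
  simpa [hzero] using norm_toLp_activation_sub_le l v 0

lemma continuous_activation {ι : Type*} (l : ℕ) :
    Continuous (activation l : (ι → ℝ) → ι → ℝ) := by
  cases l with
  | zero => exact continuous_id
  | succ l => exact continuous_relu

variable {n : ℕ} {k : ℕ → ℕ} (W : Weights n k) (x : EuclideanSpace ℝ (Fin (k 0)))

lemma layer_succ (l : ℕ) (hl : l + 1 ≤ n) :
    layer W x (l + 1) hl = W ⟨l, hl⟩ *ᵥ activation l (layer W x l (Nat.le_of_succ_le hl)) := by
  cases l <;> rfl

lemma continuous_layer (l : ℕ) (hl : l ≤ n) : Continuous fun x => layer W x l hl := by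
  induction l with
  | zero => exact PiLp.continuous_ofLp 2 _
  | succ l ih =>
    simp only [layer_succ]
    exact continuous_const.matrix_mulVec ((continuous_activation l).comp (ih _))

lemma continuous_net : Continuous (net W) := continuous_layer W n le_rfl

lemma layer_smul {c : Fin n → ℝ} (hc : ∀ i, 0 ≤ c i) (l : ℕ) (hl : l ≤ n) :
    layer (fun i => c i • W i) x l hl = (∏ i : Fin l, c (i.castLE hl)) • layer W x l hl := by
  induction l with
  | zero => simp [layer]
  | succ l ih =>
    rw [layer_succ, layer_succ, ih, activation_smul (Finset.prod_nonneg fun i _ => hc _),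
      Matrix.smul_mulVec, Matrix.mulVec_smul, smul_smul, Fin.prod_univ_castSucc, mul_comm]
    rfl

lemma net_smul {c : Fin n → ℝ} (hc : ∀ i, 0 ≤ c i) :
    net (fun i => c i • W i) x = (∏ i, c i) • net W x := layer_smul W x hc n le_rfl

lemma norm_layer_le (l : ℕ) (hl : l ≤ n) :
    ‖toLp 2 (layer W x l hl)‖ ≤ (∏ i : Fin l, ‖W (i.castLE hl)‖) * ‖x‖ := by
  induction l with
  | zero => simp [layer]
  | succ l ih =>
    rw [layer_succ, Fin.prod_univ_castSucc, mul_comm (∏ _, _), mul_assoc]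
    refine (Matrix.l2_opNorm_mulVec _ (toLp 2 _)).trans ?_
    exact mul_le_mul_of_nonneg_left ((norm_toLp_activation_le l _).trans (ih _)) (norm_nonneg _)

lemma norm_net_le : ‖toLp 2 (net W x)‖ ≤ (∏ l, ‖W l‖) * ‖x‖ := norm_layer_le W x n le_rfl

lemma norm_mulVec_sub_mulVec_le {m n : Type*} [Fintype m] [Fintype n] [DecidableEq n]
    (M N : Matrix m n ℝ) (v w : n → ℝ) :
    ‖toLp 2 (M *ᵥ v - N *ᵥ w)‖ ≤ ‖M‖ * ‖toLp 2 (v - w)‖ + ‖M - N‖ * ‖toLp 2 w‖ := by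
  have hsplit : M *ᵥ v - N *ᵥ w = M *ᵥ (v - w) + (M - N) *ᵥ w := by
    rw [Matrix.mulVec_sub, Matrix.sub_mulVec, sub_add_sub_cancel]
  rw [hsplit, WithLp.toLp_add]
  exact (norm_add_le _ _).trans
    (add_le_add (M.l2_opNorm_mulVec (toLp 2 _)) ((M - N).l2_opNorm_mulVec (toLp 2 _)))

lemma norm_layer_sub_le {U : Weights n k} {η : ℝ} (hη : 0 ≤ η)
    (hU : ∀ i, ‖U i - W i‖ ≤ η * ‖W i‖) (l : ℕ) (hl : l ≤ n) :
    ‖toLp 2 (layer U x l hl - layer W x l hl)‖ ≤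
      ((1 + η) ^ l - 1) * ((∏ i : Fin l, ‖W (i.castLE hl)‖) * ‖x‖) := by
  induction l with
  | zero => simp [layer]
  | succ l ih =>
    set i : Fin n := ⟨l, hl⟩
    set P := (∏ i : Fin l, ‖W (i.castLE (Nat.le_of_succ_le hl))‖) * ‖x‖
    have : 0 ≤ P := by positivity
    have hUi : ‖U i‖ ≤ (1 + η) * ‖W i‖ := by
      linarith [norm_le_norm_add_norm_sub' (U i) (W i), hU i]
    rw [layer_succ, layer_succ]
    calc _ ≤ ‖U i‖ * ‖toLp 2 (activation l (layer U x l _) - activation l (layer W x l _))‖ +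
          ‖U i - W i‖ * ‖toLp 2 (activation l (layer W x l _))‖ := norm_mulVec_sub_mulVec_le _ _ _ _
      _ ≤ (1 + η) * ‖W i‖ * (((1 + η) ^ l - 1) * P) + η * ‖W i‖ * P := by
          gcongr
          · exact (norm_toLp_activation_sub_le l _ _).trans (ih _)
          · exact hU i
          · exact (norm_toLp_activation_le l _).trans (norm_layer_le W x l _)
      _ = ((1 + η) ^ (l + 1) - 1) * (‖W i‖ * P) := by ring
      _ = _ := by
          rw [Fin.prod_univ_castSucc, mul_comm (∏ _, _), mul_assoc]
          rfl

lemma norm_net_sub_le {U : Weights n k} {η : ℝ} (hη : 0 ≤ η)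
    (hU : ∀ i, ‖U i - W i‖ ≤ η * ‖W i‖) :
    ‖toLp 2 (net U x - net W x)‖ ≤ ((1 + η) ^ n - 1) * ((∏ l, ‖W l‖) * ‖x‖) :=
  norm_layer_sub_le W x hη hU n le_rfl

end Networks

/-! ### A countable net of networks -/

section NetCodes

open scoped Matrix.Norms.L2Operator
open WithLp (toLp)

lemma one_add_inv_pow_sub_one_le {n a : ℕ} (hn : 0 < n) (ha : 0 < a) :
    (1 + 1 / (2 * n * a : ℝ)) ^ n - 1 ≤ 1 / a := by
  have ha1 : (1 : ℝ) ≤ a := by exact_mod_cast ha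
  have : (0 : ℝ) < n := by exact_mod_cast hn
  set y : ℝ := 1 / (2 * a) with hy
  have hy1 : y ≤ 1 / 2 := by rw [hy, div_le_div_iff₀] <;> linarith
  have hpow : (1 + 1 / (2 * n * a : ℝ)) ^ n ≤ Real.exp y := by
    calc (1 + 1 / (2 * n * a : ℝ)) ^ n ≤ Real.exp (1 / (2 * n * a : ℝ)) ^ n := by
          gcongr
          rw [add_comm]
          exact Real.add_one_le_exp _
      _ = Real.exp y := by
          rw [← Real.exp_nat_mul, hy]
          congr 1
          field_simp
  have hexp : Real.exp y ≤ 1 + 2 * y :=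
    (Real.exp_bound_div_one_sub_of_interval (by positivity) (by linarith)).trans <| by
      rw [div_le_iff₀ (by linarith)]
      nlinarith [show 0 ≤ y by positivity]
  have h2y : 2 * y = 1 / a := by
    rw [hy]
    field_simp
  linarith

/-- Codes for a countable family of networks: the resolution `a + 1`, the ranks `t l ≤ h` of the
layers, and, for each layer, a sum of `t l` rank-one matrices on a grid that is fine enough for the
resolution. -/
abbrev NetCode (n : ℕ) (k : ℕ → ℕ) (h : ℕ) : Type :=
  Σ a : ℕ, Σ t : Fin n → Fin (h + 1),
    (l : Fin n) → MatrixCode (Fin (k (l + 1))) (Fin (k l)) (8 * n * (a + 1) * h ^ 2) (t l)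

variable {n h : ℕ} {k : ℕ → ℕ}

/-- The weights described by a code. -/
def NetCode.weights (c : NetCode n k h) : Weights n k := fun l => (c.2.2 l).toMatrix

/-- The scores described by a code, for inputs of norm at most `R` and accuracy `γ / 4`. The weights
of a code approximate normalized layers; the product of the norms of the layers is restored by a
multiple of `γ / (8 * R)`. -/
def NetCode.scores (R γ : ℝ) (c : NetCode n k h) : EuclideanSpace ℝ (Fin (k 0)) → Fin (k n) → ℝ :=
  ((c.1 + 1 : ℕ) * γ / (8 * R)) • net c.weights

lemma NetCode.continuous_scores (R γ : ℝ) (c : NetCode n k h) : Continuous (c.scores R γ) :=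
  (continuous_net c.weights).const_smul _

lemma exists_netCode_norm_sub_le (hk : ∀ l ≤ n, k l ≤ h) (hh : 0 < h) (hn : 0 < n)
    (a : ℕ) {V : Weights n k} (hV : ∀ l, ‖V l‖ ≤ 1) :
    ∃ c : NetCode n k h, c.1 = a ∧
      (∀ l, ((c.2.1 l : ℕ) : ℝ) ≤ 16 * n ^ 2 * (a + 1) ^ 2 * frobSq (V l) + 1) ∧
      ∀ l, ‖V l - c.weights l‖ ≤ 1 / (2 * n * (a + 1 : ℕ)) := by
  have happrox (l : Fin n) := exists_matrixCode_of_norm_le_one (h := h)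
    (N := 8 * n * (a + 1) * h ^ 2) (e := 1 / (4 * n * (a + 1))) (by simpa using hk _ l.2)
    (by simpa using hk _ l.2.le) (by positivity) (by positivity) (hV l)
  choose t hth ht c hc using happrox
  refine ⟨⟨a, fun l => ⟨t l, Nat.lt_succ_of_le (hth l)⟩, c⟩, rfl, fun l => (ht l).trans_eq ?_,
    fun l => (hc l).trans_eq ?_⟩
  · rw [frobSq]
    field_simp
    ring
  · push_cast
    field_simp
    norm_num

lemma norm_smul_net_sub_net_le {W U : Weights n k} (hW : ∀ l, ‖W l‖ ≠ 0) {η β : ℝ} (hη : 0 ≤ η)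
    (hU : ∀ l, ‖‖W l‖⁻¹ • W l - U l‖ ≤ η) (hβ : ∏ l, ‖W l‖ ≤ β)
    (x : EuclideanSpace ℝ (Fin (k 0))) :
    ‖toLp 2 (β • net U x - net W x)‖ ≤
      (β * ((1 + η) ^ n - 1) + (β - ∏ l, ‖W l‖)) * ‖x‖ := by
  set V : Weights n k := fun l => ‖W l‖⁻¹ • W l with hVdef
  have hV (l) : ‖V l‖ = 1 := by rw [hVdef, norm_smul, norm_inv, norm_norm, inv_mul_cancel₀ (hW l)]
  have hnet : net W x = (∏ l, ‖W l‖) • net V x := by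
    rw [← net_smul V x fun l => norm_nonneg _]
    simp only [hVdef, smul_inv_smul₀ (hW _)]
  have hβ0 : 0 ≤ β := (Finset.prod_nonneg fun l _ => norm_nonneg _).trans hβ
  have hUV : ‖toLp 2 (net U x - net V x)‖ ≤ ((1 + η) ^ n - 1) * ‖x‖ := by
    simpa [hV] using norm_net_sub_le V x hη fun l => by
      rw [norm_sub_rev, hV, mul_one]
      exact hU l
  have hVx : ‖toLp 2 (net V x)‖ ≤ ‖x‖ := by simpa [hV] using norm_net_le V x
  have hsplit : toLp 2 (β • net U x - net W x) =
      β • toLp 2 (net U x - net V x) + (β - ∏ l, ‖W l‖) • toLp 2 (net V x) := by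
    rw [hnet, ← WithLp.toLp_smul, ← WithLp.toLp_smul, ← WithLp.toLp_add, smul_sub, sub_smul,
      sub_add_sub_cancel]
  calc ‖toLp 2 (β • net U x - net W x)‖
      ≤ β * ‖toLp 2 (net U x - net V x)‖ + (β - ∏ l, ‖W l‖) * ‖toLp 2 (net V x)‖ := by
        rw [hsplit]
        refine (norm_add_le _ _).trans_eq ?_
        rw [norm_smul, norm_smul, Real.norm_of_nonneg hβ0, Real.norm_of_nonneg (sub_nonneg.2 hβ)]
    _ ≤ β * (((1 + η) ^ n - 1) * ‖x‖) + (β - ∏ l, ‖W l‖) * ‖x‖ := by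
        gcongr
    _ = _ := by ring

lemma scale_error_le {a : ℕ} (hn : 0 < n) (ha : 0 < a) {α R γ : ℝ} (hR : 0 < R) (hγ : 0 < γ)
    (hle : 8 * (R * α / γ) ≤ a) (hge : a ≤ 8 * (R * α / γ) + 1) :
    α ≤ a * γ / (8 * R) ∧
      a * γ / (8 * R) * ((1 + 1 / (2 * n * a : ℝ)) ^ n - 1) + (a * γ / (8 * R) - α) ≤
        γ / (4 * R) := by
  have hα : 8 * (R * α / γ) * (γ / (8 * R)) = α := by field_simp
  have : 0 ≤ γ / (8 * R) := by positivity
  refine ⟨?_, ?_⟩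
  · calc α = 8 * (R * α / γ) * (γ / (8 * R)) := hα.symm
      _ ≤ a * (γ / (8 * R)) := by gcongr
      _ = a * γ / (8 * R) := by ring
  · calc _ ≤ a * γ / (8 * R) * (1 / a) + γ / (8 * R) := by
          gcongr
          · exact one_add_inv_pow_sub_one_le hn ha
          · rw [sub_le_iff_le_add']
            calc a * γ / (8 * R) = a * (γ / (8 * R)) := by ring
              _ ≤ (8 * (R * α / γ) + 1) * (γ / (8 * R)) := by gcongr
              _ = α + γ / (8 * R) := by rw [add_mul, hα, one_mul]
      _ = γ / (4 * R) := by
          field_simp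
          norm_num

-- The resolution is `⌈8 R α / γ⌉`, where `α` is the product of the norms of the layers.
lemma exists_netCode_norm_scores_sub_le (hk : ∀ l ≤ n, k l ≤ h) (hh : 0 < h) (hn : 0 < n)
    {W : Weights n k} (hW : ∀ l, ‖W l‖ ≠ 0) {R γ : ℝ} (hR : 0 < R) (hγ : 0 < γ) :
    ∃ c : NetCode n k h, (c.1 : ℝ) < 8 * (R * (∏ l, ‖W l‖) / γ) ∧
      (∀ l, ((c.2.1 l : ℕ) : ℝ) ≤ 16 * n ^ 2 * (c.1 + 1) ^ 2 * (frobSq (W l) / ‖W l‖ ^ 2) + 1) ∧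
      ∀ x, ‖x‖ ≤ R → ‖toLp 2 (c.scores R γ x - net W x)‖ ≤ γ / 4 := by
  have hα : 0 < ∏ l, ‖W l‖ := Finset.prod_pos fun l _ => (norm_nonneg _).lt_of_ne' (hW l)
  obtain ⟨a, hae⟩ : ∃ a, ⌈8 * (R * (∏ l, ‖W l‖) / γ)⌉₊ = a + 1 :=
    Nat.exists_eq_add_one.2 (Nat.ceil_pos.2 (by positivity))
  have hlt : (a : ℝ) < 8 * (R * (∏ l, ‖W l‖) / γ) := Nat.lt_ceil.1 (by omega)
  have hV (l) : ‖‖W l‖⁻¹ • W l‖ ≤ 1 := by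
    rw [norm_smul, norm_inv, norm_norm, inv_mul_cancel₀ (hW l)]
  obtain ⟨c, rfl, hct, hc⟩ := exists_netCode_norm_sub_le hk hh hn a hV
  refine ⟨c, hlt, fun l => (hct l).trans_eq ?_, fun x hx => ?_⟩
  · simp only [frobSq, Matrix.smul_apply, smul_eq_mul, mul_pow, ← Finset.mul_sum]
    ring
  · obtain ⟨hβ, herr⟩ := scale_error_le hn c.1.succ_pos hR hγ (hae ▸ Nat.le_ceil _) <| by
      push_cast
      linarith
    calc _ ≤ _ := norm_smul_net_sub_net_le hW (by positivity) hc hβ x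
      _ ≤ γ / (4 * R) * R := by gcongr
      _ = γ / 4 := by field_simp

end NetCodes

/-! ### Code lengths and simultaneous frequency bounds -/

/-- Kraft's inequality: `Λ i` can serve as the length (in nats) of a code word for `i`. The weights
`exp (-Λ i)` then drive a union bound over `i`. -/
def IsCodeLength {κ : Type*} (Λ : κ → ℝ) : Prop := ∑' i, ENNReal.ofReal (Real.exp (-Λ i)) ≤ 1

section CodeLength

variable {κ : Type*}

lemma isCodeLength_nat : IsCodeLength fun a : ℕ => Real.log ((a + 1) * (a + 2)) := by
  have htelescope (N : ℕ) :
      ∑ a ∈ Finset.range N, Real.exp (-Real.log ((a + 1) * (a + 2))) = 1 - 1 / (N + 1) := by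
    induction N with
    | zero => simp
    | succ N ih =>
      rw [Finset.sum_range_succ, ih, Real.exp_neg, Real.exp_log (by positivity)]
      push_cast
      field_simp
      ring
  refine ENNReal.tsum_le_of_sum_range_le fun N => ?_
  rw [← ENNReal.ofReal_sum_of_nonneg fun a _ => (Real.exp_pos _).le, htelescope,
    ENNReal.ofReal_le_one, sub_le_self_iff]
  positivity

lemma isCodeLength_log_card [Finite κ] : IsCodeLength fun _ : κ => Real.log (Nat.card κ) := by
  have := Fintype.ofFinite κ
  rcases isEmpty_or_nonempty κ with hκ | hκ
  · simp [IsCodeLength]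
  · rw [IsCodeLength, tsum_fintype, Finset.sum_const, Finset.card_univ, nsmul_eq_mul, Real.exp_neg,
      Real.exp_log (by exact_mod_cast Nat.card_pos), Nat.card_eq_fintype_card,
      ENNReal.ofReal_inv_of_pos (by exact_mod_cast Fintype.card_pos), ENNReal.ofReal_natCast]
    exact ENNReal.mul_inv_le_one _

lemma IsCodeLength.sigma {β : κ → Type*} {Λ : κ → ℝ} {M : ∀ i, β i → ℝ} (hΛ : IsCodeLength Λ)
    (hM : ∀ i, IsCodeLength (M i)) : IsCodeLength fun p : Σ i, β i => Λ p.1 + M p.1 p.2 := by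
  calc ∑' p : Σ i, β i, ENNReal.ofReal (Real.exp (-(Λ p.1 + M p.1 p.2)))
      = ∑' i, ENNReal.ofReal (Real.exp (-Λ i)) * ∑' b, ENNReal.ofReal (Real.exp (-M i b)) := by
        simp only [ENNReal.tsum_sigma', neg_add, Real.exp_add,
          ENNReal.ofReal_mul (Real.exp_pos _).le, ENNReal.tsum_mul_left]
    _ ≤ ∑' i, ENNReal.ofReal (Real.exp (-Λ i)) :=
        ENNReal.tsum_le_tsum fun i => mul_le_of_le_one_right' (hM i)
    _ ≤ 1 := hΛ

end CodeLength

section Concentration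

variable {Ω ι : Type*} [Fintype ι]

/-- The number of points of the sample `S` in `A`. -/
def sampleCount (S : ι → Ω) (A : Set Ω) : ℕ := {q | S q ∈ A}.ncard

lemma sampleCount_eq_sum_indicator (S : ι → Ω) (A : Set Ω) :
    (sampleCount S A : ℝ) = ∑ q, A.indicator (fun _ => (1 : ℝ)) (S q) := by
  classical
  simp [sampleCount, Set.ncard_eq_toFinset_card', Set.indicator_apply, Finset.sum_boole]

/-- The exponent of the exponential supermartingale that controls the frequency of `E` among the
sample points in `L`; `p` stands for the conditional probability of `E` given `L`. -/
def hoeffdingExponent (L E : Set Ω) (p lam : ℝ) : Ω → ℝ :=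
  L.indicator fun ω => lam * (p - E.indicator (fun _ => 1) ω) - lam ^ 2 / 8

lemma sum_hoeffdingExponent (S : ι → Ω) (L E : Set Ω) (p lam : ℝ) :
    ∑ q, hoeffdingExponent L E p lam (S q) =
      sampleCount S L * (lam * p - lam ^ 2 / 8) - lam * sampleCount S (L ∩ E) := by
  rw [sampleCount_eq_sum_indicator, sampleCount_eq_sum_indicator, Finset.sum_mul, Finset.mul_sum,
    ← Finset.sum_sub_distrib]
  refine Finset.sum_congr rfl fun q _ => ?_
  by_cases hL : S q ∈ L <;> by_cases hE : S q ∈ E <;> simp [hoeffdingExponent, hL, hE]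
  ring

variable [MeasurableSpace Ω]

/-- The conditional probability of `E` given `L` exceeds the frequency of `E` among the sample
points in `L` by at most `√(x / (2 N))`, where `N` is the number of these points. The inequality is
multiplied by `N`, so that it holds trivially when `N = 0`. -/
def FrequencyBound (D : Measure Ω) (S : ι → Ω) (L E : Set Ω) (x : ℝ) : Prop :=
  sampleCount S L * (cond D L).real E ≤ sampleCount S (L ∩ E) + √(sampleCount S L * x / 2)

variable {L E : Set Ω}

lemma measurable_hoeffdingExponent (hL : MeasurableSet L) (hE : MeasurableSet E) (p lam : ℝ) :
    Measurable (hoeffdingExponent L E p lam) :=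
  (((measurable_const.sub (measurable_const.indicator hE)).const_mul lam).sub_const _).indicator hL

lemma integrable_exp_hoeffdingExponent (D : Measure Ω) [IsFiniteMeasure D] (hL : MeasurableSet L)
    (hE : MeasurableSet E) (p lam : ℝ) :
    Integrable (fun ω => Real.exp (hoeffdingExponent L E p lam ω)) D := by
  refine Integrable.of_bound (measurable_hoeffdingExponent hL hE p lam).exp.aestronglyMeasurable
    (Real.exp (|lam| * (|p| + 1))) (ae_of_all _ fun ω => ?_)
  rw [Real.norm_eq_abs, Real.abs_exp, Real.exp_le_exp]
  refine Set.indicator_apply_le' (fun _ => ?_) fun _ => by positivity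
  have hbound : |p - E.indicator (fun _ => 1) ω| ≤ |p| + 1 := by
    refine (abs_sub _ _).trans (add_le_add_right ?_ _)
    by_cases hω : ω ∈ E <;> simp [hω]
  calc lam * (p - E.indicator (fun _ => 1) ω) - lam ^ 2 / 8
      ≤ |lam * (p - E.indicator (fun _ => 1) ω)| := by
        linarith [le_abs_self (lam * (p - E.indicator (fun _ => 1) ω)), sq_nonneg lam]
    _ ≤ |lam| * (|p| + 1) := by rw [abs_mul]; gcongr

lemma integral_exp_indicator_le (Q : Measure Ω) [IsProbabilityMeasure Q] (hE : MeasurableSet E)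
    (lam : ℝ) :
    ∫ ω, Real.exp (lam * (Q.real E - E.indicator (fun _ => 1) ω) - lam ^ 2 / 8) ∂Q ≤ 1 := by
  have hsubG := (hasSubgaussianMGF_of_mem_Icc (μ := Q) (a := -1) (b := 0)
    (X := fun ω => -E.indicator (fun _ => (1 : ℝ)) ω)
    (measurable_const.indicator hE).neg.aemeasurable
    (ae_of_all _ fun ω => by by_cases hω : ω ∈ E <;> simp [hω])).mgf_le lam
  have hmean : ∫ ω, -E.indicator (fun _ => (1 : ℝ)) ω ∂Q = -Q.real E := by
    rw [integral_neg, integral_indicator_const _ hE, smul_eq_mul, mul_one]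
  rw [hmean, mgf] at hsubG
  calc ∫ ω, Real.exp (lam * (Q.real E - E.indicator (fun _ => 1) ω) - lam ^ 2 / 8) ∂Q
      = ∫ ω, Real.exp (lam * (-E.indicator (fun _ => (1 : ℝ)) ω - -Q.real E)) *
          Real.exp (-(lam ^ 2 / 8)) ∂Q := by
        congr 1 with ω
        rw [← Real.exp_add]
        ring_nf
    _ ≤ Real.exp (lam ^ 2 / 8) * Real.exp (-(lam ^ 2 / 8)) := by
        rw [integral_mul_const]
        gcongr
        refine hsubG.trans_eq ?_
        norm_num
        ring
    _ = 1 := by rw [← Real.exp_add, add_neg_cancel, Real.exp_zero]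

lemma integral_exp_hoeffdingExponent_le (D : Measure Ω) [IsProbabilityMeasure D]
    (hL : MeasurableSet L) (hE : MeasurableSet E) (lam : ℝ) :
    ∫ ω, Real.exp (hoeffdingExponent L E ((cond D L).real E) lam ω) ∂D ≤ 1 := by
  set p := (cond D L).real E with hp
  have hout : ∫ ω in Lᶜ, Real.exp (hoeffdingExponent L E p lam ω) ∂D = D.real Lᶜ := by
    rw [setIntegral_congr_fun (g := fun _ => (1 : ℝ)) hL.compl fun ω hω => by
      simp [hoeffdingExponent, Set.notMem_of_mem_compl hω]]
    simp
  have hin : ∫ ω in L, Real.exp (hoeffdingExponent L E p lam ω) ∂D ≤ D.real L := by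
    rcases eq_or_ne (D L) 0 with h0 | h0
    · simp [Measure.restrict_eq_zero.2 h0]
    have := cond_isProbabilityMeasure h0
    have hcond := integral_exp_indicator_le (cond D L) hE lam
    rw [← hp, ProbabilityTheory.cond, integral_smul_measure, ENNReal.toReal_inv, smul_eq_mul,
      inv_mul_le_iff₀ (ENNReal.toReal_pos h0 (measure_ne_top _ _)), mul_one] at hcond
    rwa [setIntegral_congr_fun hL fun ω hω => by
      rw [hoeffdingExponent, Set.indicator_of_mem hω]]
  rw [← integral_add_compl hL (integrable_exp_hoeffdingExponent D hL hE p lam), hout]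
  linarith [probReal_add_probReal_compl (μ := D) hL]

lemma measure_le_sum_le_exp_neg (D : Measure Ω) [IsProbabilityMeasure D] {g : Ω → ℝ}
    (hint : Integrable (fun ω => Real.exp (g ω)) D) (hg : ∫ ω, Real.exp (g ω) ∂D ≤ 1) (x : ℝ) :
    (Measure.pi fun _ : ι => D) {S | x ≤ ∑ q, g (S q)} ≤ ENNReal.ofReal (Real.exp (-x)) := by
  have hprod : ∫ S, ∏ q, Real.exp (g (S q)) ∂(Measure.pi fun _ : ι => D) ≤ 1 := by
    rw [integral_fintype_prod_eq_prod fun _ ω => Real.exp (g ω)]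
    exact Finset.prod_le_one (fun _ _ => integral_nonneg fun _ => (Real.exp_pos _).le) fun _ _ => hg
  have hintProd : Integrable (fun S : ι → Ω => ∏ q, Real.exp (g (S q)))
      (Measure.pi fun _ : ι => D) := Integrable.fintype_prod fun _ => hint
  have hmarkov := mul_meas_ge_le_integral_of_nonneg
    (ae_of_all _ fun S => Finset.prod_nonneg fun q _ => (Real.exp_pos _).le) hintProd (Real.exp x)
  simp only [← Real.exp_sum, Real.exp_le_exp] at hmarkov hprod
  rw [ENNReal.le_ofReal_iff_toReal_le (measure_ne_top _ _) (Real.exp_pos _).le, Real.exp_neg,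
    ← one_div, le_div_iff₀' (Real.exp_pos _)]
  exact hmarkov.trans hprod

lemma measure_sampleCount_eq_not_frequencyBound_le (D : Measure Ω) [IsProbabilityMeasure D]
    (hL : MeasurableSet L) (hE : MeasurableSet E) (s : ℕ) (x : ℝ) :
    (Measure.pi fun _ : ι => D) {S | sampleCount S L = s ∧ ¬ FrequencyBound D S L E x} ≤
      ENNReal.ofReal (Real.exp (-x)) := by
  rcases le_or_gt x 0 with hx | hx
  · exact prob_le_one.trans (ENNReal.one_le_ofReal.2 (Real.one_le_exp (neg_nonneg.2 hx)))
  rcases s.eq_zero_or_pos with rfl | hs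
  · refine (measure_mono_null (t := ∅) (fun S hS => hS.2 ?_) measure_empty).trans_le zero_le
    simp [FrequencyBound, hS.1]
  have hs' : (0 : ℝ) < s := by exact_mod_cast hs
  refine (measure_mono fun S hS => ?_).trans (measure_le_sum_le_exp_neg D
    (integrable_exp_hoeffdingExponent D hL hE ((cond D L).real E) _)
    (integral_exp_hoeffdingExponent_le D hL hE √(8 * x / s)) x)
  obtain ⟨rfl, hdev⟩ := hS
  rw [FrequencyBound, not_le] at hdev
  set N : ℝ := (sampleCount S L : ℝ)
  -- `√(8 x / N)` minimizes `lam ↦ N lam ^ 2 / 8 - lam √(N x / 2)`, with minimal value `-x`.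
  set lam := √(8 * x / N)
  have hsq : N * (lam ^ 2 / 8) = x := by
    rw [Real.sq_sqrt (by positivity)]
    field_simp
  have hmul : lam * √(N * x / 2) = 2 * x := by
    rw [← Real.sqrt_mul (by positivity), show 8 * x / N * (N * x / 2) = (2 * x) ^ 2 by
      field_simp
      ring]
    exact Real.sqrt_sq (by positivity)
  have hmono := mul_le_mul_of_nonneg_left hdev.le (Real.sqrt_nonneg (8 * x / N))
  rw [Set.mem_ofPred_eq, sum_hoeffdingExponent]
  linarith

lemma measure_not_forall_frequencyBound_le (D : Measure Ω) [IsProbabilityMeasure D] {κ : Type*}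
    [Countable κ] {Λ : κ → ℝ} (hΛ : IsCodeLength Λ) {L E : κ → Set Ω}
    (hL : ∀ i, MeasurableSet (L i)) (hE : ∀ i, MeasurableSet (E i)) {δ : ℝ} (hδ : 0 < δ) :
    (Measure.pi fun _ : ι => D) {S | ¬ ∀ i, FrequencyBound D S (L i) (E i)
      (Λ i + Real.log ((sampleCount S (L i) + 1) * (sampleCount S (L i) + 2) / δ))} ≤
      ENNReal.ofReal δ := by
  set code : (Σ _ : κ, ℕ) → ℝ := fun p => Λ p.1 + Real.log ((p.2 + 1) * (p.2 + 2))
  have hcode : IsCodeLength code := hΛ.sigma fun _ => isCodeLength_nat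
  calc _ ≤ (Measure.pi fun _ : ι => D) (⋃ p : Σ _ : κ, ℕ, {S | sampleCount S (L p.1) = p.2 ∧
        ¬ FrequencyBound D S (L p.1) (E p.1) (code p - Real.log δ)}) := by
        refine measure_mono fun S hS => ?_
        obtain ⟨i, hi⟩ := not_forall.1 hS
        refine Set.mem_iUnion.2 ⟨⟨i, sampleCount S (L i)⟩, rfl, ?_⟩
        rwa [Real.log_div (by positivity) hδ.ne', ← add_sub_assoc] at hi
    _ ≤ ∑' p : Σ _ : κ, ℕ, ENNReal.ofReal (Real.exp (-(code p - Real.log δ))) :=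
        (measure_iUnion_le _).trans <| ENNReal.tsum_le_tsum fun p =>
          measure_sampleCount_eq_not_frequencyBound_le D (hL _) (hE _) _ _
    _ = (∑' p, ENNReal.ofReal (Real.exp (-code p))) * ENNReal.ofReal δ := by
        rw [← ENNReal.tsum_mul_right]
        congr 1 with p
        rw [← ENNReal.ofReal_mul (Real.exp_pos _).le, neg_sub, sub_eq_neg_add, Real.exp_add,
          Real.exp_log hδ]
    _ ≤ 1 * ENNReal.ofReal δ := by gcongr; exact hcode
    _ = ENNReal.ofReal δ := one_mul _

end Concentration

/-! ### Margins and confusion matrices -/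

section Margins

variable {c : ℕ} {z : Fin c → ℝ} {i j : Fin c}

lemma lipschitzWith_margin (j : Fin c) : LipschitzWith 2 fun z => margin z j :=
  LipschitzWith.of_le_add_mul 2 fun z z' => by
    have hsup : ⨆ i : {i // i ≠ j}, z' i ≤ (⨆ i : {i // i ≠ j}, z i) + dist z z' := by
      rcases isEmpty_or_nonempty {i // i ≠ j} with _ | _
      · simp
      · refine ciSup_le fun i => ?_
        have hle : z i ≤ ⨆ i : {i // i ≠ j}, z i :=
          le_ciSup (f := fun i : {i // i ≠ j} => z i) (Set.finite_range _).bddAbove i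
        linarith [(abs_le.1 (dist_le_pi_dist z z' (i : Fin c))).1]
    simp only [margin, NNReal.coe_ofNat]
    linarith [(abs_le.1 (dist_le_pi_dist z z' j)).2]

lemma margin_le_of_norm_sub_le {e : ℝ} {z' : Fin c → ℝ} (j : Fin c)
    (h : ‖WithLp.toLp 2 (z - z')‖ ≤ e) : margin z j ≤ margin z' j + 2 * e := by
  have hdist : dist z z' ≤ e :=
    (dist_pi_le_iff ((norm_nonneg _).trans h)).2 fun i => (PiLp.norm_apply_le _ i).trans h
  have hlip := (lipschitzWith_margin j).le_add_mul z z'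
  simp only [NNReal.coe_ofNat] at hlip
  linarith

lemma Predicts.margin_nonpos (h : Predicts z j i) (hij : i ≠ j) : margin z j ≤ 0 :=
  sub_nonpos.2 <| (h.1 j).trans <|
    le_ciSup (f := fun i : {i // i ≠ j} => z i) (Set.finite_range _).bddAbove ⟨i, hij⟩

lemma Predicts.unique {i' : Fin c} (hi : i ≠ j) (hi' : i' ≠ j) (h : Predicts z j i)
    (h' : Predicts z j i') : i = i' := by
  rcases lt_trichotomy i i' with hlt | heq | hlt
  · exact absurd (h'.2 i hi hlt) (h.1 i').not_gt
  · exact heq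
  · exact absurd (h.2 i' hi' hlt) (h'.1 i).not_gt

lemma IsArgmaxWrong.margin_eq (h : IsArgmaxWrong z j i) : margin z j = z j - z i := by
  have : Nonempty {i // i ≠ j} := ⟨⟨i, h.1⟩⟩
  have hsup : ⨆ i : {i // i ≠ j}, z i = z i := le_antisymm (ciSup_le fun i' => h.2.1 i' i'.2)
    (le_ciSup (f := fun i : {i // i ≠ j} => z i) (Set.finite_range _).bddAbove ⟨i, h.1⟩)
  rw [margin, hsup]

lemma exists_isArgmaxWrong [Nontrivial (Fin c)] (z : Fin c → ℝ) (j : Fin c) :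
    ∃ i, IsArgmaxWrong z j i := by
  obtain ⟨i₀, hi₀⟩ := exists_ne j
  obtain ⟨i, hi, hmin⟩ := Finset.exists_min_image (Finset.univ.filter fun i => i ≠ j)
    (fun i => toLex (-z i, i)) ⟨i₀, by simpa using hi₀⟩
  have hmin' : ∀ i', i' ≠ j → z i' < z i ∨ z i' = z i ∧ i ≤ i' := fun i' hi' => by
    simpa [Prod.Lex.le_iff, eq_comm] using hmin i' (by simpa using hi')
  exact ⟨i, by simpa using hi, fun i' hi' => (hmin' i' hi').elim le_of_lt fun h => h.1.le,
    fun i' hi' hlt => (hmin' i' hi').resolve_right fun h => h.2.not_gt hlt⟩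

lemma IsAttack.margin_le {d : ℕ} {B ε : ℝ} {ℓ : (Fin c → ℝ) → Fin c → ℝ}
    {f : EuclideanSpace ℝ (Fin d) → Fin c → ℝ}
    {A : EuclideanSpace ℝ (Fin d) × Fin c → EuclideanSpace ℝ (Fin d)} (hA : IsAttack B ε ℓ f A)
    (hℓ : IsMarginLoss ℓ) {x x' : EuclideanSpace ℝ (Fin d)} {y : Fin c} (hx : ‖x‖ ≤ B)
    (hx' : ‖x' - x‖ ≤ ε) : margin (f (A (x, y))) y ≤ margin (f x') y :=
  not_lt.1 fun hlt => (hℓ _ _ _ hlt).not_ge (hA.isMax x y hx x' hx')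

end Margins

section Confusion

variable {X : Type*} {m c : ℕ}

lemma sampleCount_label (S : Fin m → X × Fin c) (j : Fin c) :
    sampleCount S {p | p.2 = j} = classCount S j := by
  simp [sampleCount, classCount, Set.ncard_eq_toFinset_card']

lemma sampleCount_mono {Ω Ω' : Type*} {S : Fin m → Ω} {S' : Fin m → Ω'} {E : Set Ω} {E' : Set Ω'}
    (h : ∀ q, S q ∈ E → S' q ∈ E') : sampleCount S E ≤ sampleCount S' E' :=
  Set.ncard_le_ncard h (Set.toFinite _)

lemma marginConfusion_apply_of_ne (γ : ℝ) (f : X → Fin c → ℝ) (S : Fin m → X × Fin c)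
    {i j : Fin c} (hij : i ≠ j) :
    marginConfusion γ f S i j = sampleCount S {p | p.2 = j ∧ margin (f p.1) j ≤ γ ∧
      IsArgmaxWrong (f p.1) j i} / classCount S j := by
  classical
  rw [sampleCount_eq_sum_indicator, div_eq_inv_mul, Finset.mul_sum, marginConfusion,
    Matrix.of_apply, if_neg hij]
  refine Finset.sum_congr rfl fun q _ => ?_
  rw [one_div, Set.indicator_apply]
  congr 2
  refine propext ⟨?_, ?_⟩
  · rintro ⟨hle, rfl, harg⟩
    exact ⟨rfl, by rw [harg.margin_eq]; linarith, harg⟩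
  · rintro ⟨rfl, hle, harg⟩
    rw [harg.margin_eq] at hle
    exact ⟨by linarith, rfl, harg⟩

lemma sampleCount_div_le_sum_abs_marginConfusion [Nontrivial (Fin c)] (γ : ℝ) (f : X → Fin c → ℝ)
    (S : Fin m → X × Fin c) (j : Fin c) :
    sampleCount S ({p | p.2 = j} ∩ {p | margin (f p.1) j ≤ γ}) / classCount S j ≤
      ∑ i, |marginConfusion γ f S i j| := by
  set F : Fin c → Set (X × Fin c) := fun i =>
    {p | p.2 = j ∧ margin (f p.1) j ≤ γ ∧ IsArgmaxWrong (f p.1) j i}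
  have hcover : sampleCount S ({p | p.2 = j} ∩ {p | margin (f p.1) j ≤ γ}) ≤
      ∑ i ∈ Finset.univ.erase j, sampleCount S (F i) := by
    refine (Set.ncard_le_ncard (fun q hq => ?_) (Set.toFinite _)).trans
      (Finset.set_ncard_biUnion_le _ fun i => {q | S q ∈ F i})
    obtain ⟨i, hi⟩ := exists_isArgmaxWrong (f (S q).1) j
    exact Set.mem_biUnion (Finset.mem_erase.2 ⟨hi.1, Finset.mem_univ i⟩) ⟨hq.1, hq.2, hi⟩
  calc (sampleCount S ({p | p.2 = j} ∩ {p | margin (f p.1) j ≤ γ}) : ℝ) / classCount S j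
      ≤ (∑ i ∈ Finset.univ.erase j, sampleCount S (F i) : ℕ) / classCount S j := by gcongr
    _ = ∑ i ∈ Finset.univ.erase j, marginConfusion γ f S i j := by
        rw [Nat.cast_sum, Finset.sum_div]
        exact Finset.sum_congr rfl fun i hi =>
          (marginConfusion_apply_of_ne γ f S (Finset.ne_of_mem_erase hi)).symm
    _ ≤ ∑ i ∈ Finset.univ.erase j, |marginConfusion γ f S i j| :=
        Finset.sum_le_sum fun i _ => le_abs_self _
    _ ≤ ∑ i, |marginConfusion γ f S i j| :=
        Finset.sum_le_univ_sum_of_nonneg fun i => abs_nonneg _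

variable [MeasurableSpace X]

lemma measurableSet_label (j : Fin c) : MeasurableSet {p : X × Fin c | p.2 = j} :=
  measurable_snd (measurableSet_singleton j)

lemma measurableSet_predicts {f : X → Fin c → ℝ} (hf : Measurable f) (j i : Fin c) :
    MeasurableSet {x | Predicts (f x) j i} := by
  have hfi : ∀ i, Measurable fun x => f x i := fun i => (measurable_pi_apply i).comp hf
  simp only [Predicts, Set.ofPred_forall, Set.ofPred_and]
  exact (MeasurableSet.iInter fun i' => measurableSet_le (hfi i') (hfi i)).inter
    (MeasurableSet.iInter fun i' => MeasurableSet.iInter fun _ => MeasurableSet.iInter fun _ =>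
      measurableSet_lt (hfi i') (hfi i))

lemma cond_advMeasure_real {A : X × Fin c → X} (hA : Measurable A) (D : Measure (X × Fin c))
    (j : Fin c) {s : Set (X × Fin c)} (hs : MeasurableSet s) :
    (cond (advMeasure A D) {p | p.2 = j}).real s =
      (cond D {p | p.2 = j}).real {p | (A p, p.2) ∈ s} := by
  have hT : Measurable fun p : X × Fin c => (A p, p.2) := hA.prodMk measurable_snd
  have hj := measurableSet_label (X := X) j
  rw [Measure.real, Measure.real, cond_apply hj, cond_apply hj, advMeasure,
    Measure.map_apply hT hj, Measure.map_apply hT (hj.inter hs)]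
  rfl

lemma trueConfusion_advMeasure_apply_of_ne {f : X → Fin c → ℝ} (hf : Measurable f)
    {A : X × Fin c → X} (hA : Measurable A) (D : Measure (X × Fin c)) {i j : Fin c} (hij : i ≠ j) :
    trueConfusion f (advMeasure A D) i j =
      (cond D {p | p.2 = j}).real {p | Predicts (f (A p)) j i} := by
  rw [trueConfusion, Matrix.of_apply, if_neg hij]
  exact cond_advMeasure_real hA D j (measurableSet_predicts (hf.comp measurable_fst) j i)

lemma sum_abs_trueConfusion_le {f : X → Fin c → ℝ} (hf : Measurable f) {A : X × Fin c → X}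
    (hA : Measurable A) (D : Measure (X × Fin c)) (j : Fin c) :
    ∑ i, |trueConfusion f (advMeasure A D) i j| ≤
      (cond D {p | p.2 = j}).real {p | margin (f (A p)) j ≤ 0} := by
  calc ∑ i, |trueConfusion f (advMeasure A D) i j|
      = ∑ i ∈ Finset.univ.erase j, |trueConfusion f (advMeasure A D) i j| :=
        (Finset.sum_erase _ (by simp [trueConfusion])).symm
    _ = ∑ i ∈ Finset.univ.erase j,
          (cond D {p | p.2 = j}).real {p | Predicts (f (A p)) j i} := by
        refine Finset.sum_congr rfl fun i hi => ?_
        rw [trueConfusion_advMeasure_apply_of_ne hf hA D (Finset.ne_of_mem_erase hi),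
          abs_of_nonneg measureReal_nonneg]
    _ = (cond D {p | p.2 = j}).real
          (⋃ i ∈ Finset.univ.erase j, {p | Predicts (f (A p)) j i}) := by
        refine (measureReal_biUnion_finset (fun i hi i' hi' hne => ?_) fun i _ =>
          measurableSet_predicts (hf.comp hA) j i).symm
        exact Set.disjoint_left.2 fun p hp hp' => hne <|
          Predicts.unique (Finset.ne_of_mem_erase hi) (Finset.ne_of_mem_erase hi') hp hp'
    _ ≤ (cond D {p | p.2 = j}).real {p | margin (f (A p)) j ≤ 0} := by
        refine measureReal_mono (Set.iUnion₂_subset fun i hi p hp => ?_)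
        exact Predicts.margin_nonpos hp (Finset.ne_of_mem_erase hi)

open scoped Matrix.Norms.L2Operator in
lemma specNorm_nonneg {p q : ℕ} (M : Matrix (Fin p) (Fin q) ℝ) : 0 ≤ specNorm M := norm_nonneg M

open scoped Matrix.Norms.L2Operator in
lemma sum_abs_col_le_specNorm {p q : ℕ} (M : Matrix (Fin p) (Fin q) ℝ) (j : Fin q) :
    ∑ i, |M i j| ≤ √p * specNorm M := by
  have h := sum_abs_col_le M j
  rwa [Fintype.card_fin] at h

lemma colNorm_le {p q : ℕ} {M : Matrix (Fin p) (Fin q) ℝ} {a : ℝ} (ha : 0 ≤ a)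
    (h : ∀ j, ∑ i, |M i j| ≤ a) : colNorm M ≤ a :=
  Real.iSup_le h ha

lemma colNorm_trueConfusion_le [Nontrivial (Fin c)] {γ : ℝ} {f : X → Fin c → ℝ} (hf : Measurable f)
    {A : X × Fin c → X} (hA : Measurable A) {D : Measure (X × Fin c)} {S : Fin m → X × Fin c}
    {E : Fin c → Set (X × Fin c)} {τ : ℝ} (hτ : 0 ≤ τ)
    (htrue : ∀ j, ∀ᵐ p ∂D, margin (f (A p)) j ≤ 0 → p ∈ E j)
    (hemp : ∀ q, S q ∈ E (S q).2 → margin (f (A (S q))) (S q).2 ≤ γ)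
    (hdev : ∀ j, (cond D {p | p.2 = j}).real (E j) ≤
      sampleCount S ({p | p.2 = j} ∩ E j) / classCount S j + τ) :
    colNorm (trueConfusion f (advMeasure A D)) ≤
      √c * specNorm (marginConfusion γ f (advSample A S)) + τ := by
  have hfreq (j : Fin c) : (sampleCount S ({p | p.2 = j} ∩ E j) : ℝ) / classCount S j ≤
      √c * specNorm (marginConfusion γ f (advSample A S)) := by
    calc (sampleCount S ({p | p.2 = j} ∩ E j) : ℝ) / classCount S j
        ≤ sampleCount (advSample A S) ({p | p.2 = j} ∩ {p | margin (f p.1) j ≤ γ}) /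
            classCount (advSample A S) j := by
          refine div_le_div_of_nonneg_right ?_ (Nat.cast_nonneg _)
          refine Nat.cast_le.2 (sampleCount_mono fun q hq => ⟨hq.1, ?_⟩)
          obtain ⟨rfl, hq⟩ := hq
          exact hemp q hq
      _ ≤ ∑ i, |marginConfusion γ f (advSample A S) i j| :=
          sampleCount_div_le_sum_abs_marginConfusion γ f _ j
      _ ≤ √c * specNorm (marginConfusion γ f (advSample A S)) :=
          sum_abs_col_le_specNorm _ j
  refine colNorm_le
    (add_nonneg (mul_nonneg (Real.sqrt_nonneg _) (specNorm_nonneg _)) hτ) fun j => ?_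
  calc ∑ i, |trueConfusion f (advMeasure A D) i j|
      ≤ (cond D {p | p.2 = j}).real {p | margin (f (A p)) j ≤ 0} :=
        sum_abs_trueConfusion_le hf hA D j
    _ ≤ (cond D {p | p.2 = j}).real (E j) := by
        refine ENNReal.toReal_mono (measure_ne_top _ _) (measure_mono_ae ?_)
        exact cond_absolutelyContinuous.ae_le (htrue j)
    _ ≤ _ := (hdev j).trans (add_le_add_left (hfreq j) τ)

end Confusion

/-! ### From frequency bounds to the robust bound -/

section RobustBounds

variable {n m h : ℕ} {k : ℕ → ℕ} {B ε δ γ C ν : ℝ}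
  {D : Measure (EuclideanSpace ℝ (Fin (k 0)) × Fin (k n))}
  {S : Fin m → EuclideanSpace ℝ (Fin (k 0)) × Fin (k n)} {W : Weights n k}
  {A : EuclideanSpace ℝ (Fin (k 0)) × Fin (k n) → EuclideanSpace ℝ (Fin (k 0))}

lemma complexity_nonneg (h : ℕ) (B ε : ℝ) (W : Weights n k) : 0 ≤ complexity h B ε W := by
  have hlog : 0 ≤ Real.log (n * h) := by exact_mod_cast Real.log_natCast_nonneg (n * h)
  have : 0 ≤ ∏ l, specNorm (W l) ^ 2 := Finset.prod_nonneg fun _ _ => sq_nonneg _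
  have hsum : 0 ≤ ∑ l, frobSq (W l) / specNorm (W l) ^ 2 := Finset.sum_nonneg fun l _ =>
    div_nonneg (Finset.sum_nonneg fun i _ => Finset.sum_nonneg fun j _ => sq_nonneg _) (sq_nonneg _)
  unfold complexity
  positivity

lemma log_add_log_mul_succ_div_le {c s : ℕ} (hc : 0 < c) (hcs : c ≤ s) (hs : 3 ≤ s) (hδ : 0 < δ)
    (hδ1 : δ ≤ 1) : Real.log c + Real.log ((s + 1) * (s + 2) / δ) ≤ 4 * Real.log (s / δ) := by
  have hs' : (3 : ℝ) ≤ s := by exact_mod_cast hs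
  have hsδ : (s : ℝ) ^ 3 / δ ≤ (s / δ) ^ 3 := by
    rw [div_pow]
    gcongr
    exact pow_le_of_le_one hδ.le hδ1 three_ne_zero
  have hcub : ((s : ℝ) + 1) * (s + 2) / δ ≤ s ^ 3 / δ := by
    gcongr
    nlinarith [mul_nonneg (sub_nonneg.2 hs') (sq_nonneg (s : ℝ))]
  have hlogc : Real.log c ≤ Real.log (s / δ) :=
    Real.log_le_log (by exact_mod_cast hc) <|
      (Nat.cast_le.2 hcs).trans (le_div_self (by positivity) hδ hδ1)
  have hlogs : Real.log ((s + 1) * (s + 2) / δ) ≤ Real.log ((s / δ) ^ 3) :=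
    Real.log_le_log (by positivity) (hcub.trans hsδ)
  rw [Real.log_pow, Nat.cast_ofNat] at hlogs
  linarith

lemma log_div_div_le {M s : ℝ} (hM : 3 ≤ M) (hMs : M ≤ s) (hδ : 0 < δ) (hδ1 : δ ≤ 1) :
    Real.log (s / δ) / s ≤ Real.log (M / δ) / M := by
  have hexp (x : ℝ) (hx : 3 ≤ x) : Real.exp 1 ≤ x / δ :=
    (Real.exp_one_lt_three.le.trans hx).trans (le_div_self (by linarith) hδ hδ1)
  have hanti := Real.log_div_self_antitoneOn (hexp M hM) (hexp s (hM.trans hMs)) (by gcongr)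
  simp only [div_div_eq_mul_div] at hanti
  rw [mul_div_right_comm, mul_div_right_comm] at hanti
  exact le_of_mul_le_mul_right hanti hδ

lemma sqrt_deviation_le {c M s : ℕ} {u Λ φ ℓ : ℝ} (hc : 0 < c) (hM : 8 * c < M) (hMs : M ≤ s)
    (hδ : 0 < δ) (hδ1 : δ ≤ 1) (hC : 2 ≤ C) (hu : 1 ≤ u) (hφ : 0 ≤ φ) (hΛ : Λ ≤ C ^ 2 * φ)
    (hℓ : Real.log (M / δ) ≤ ℓ) :
    √((Λ + Real.log c + Real.log ((s + 1) * (s + 2) / δ)) / (2 * s)) ≤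
      C * √(u / (M - 8 * c) * (φ + ℓ)) := by
  have hM3 : (3 : ℝ) ≤ M := by exact_mod_cast (by omega : 3 ≤ M)
  have hMs' : (M : ℝ) ≤ s := by exact_mod_cast hMs
  have hcM : (0 : ℝ) < M - 8 * c := sub_pos.2 (by exact_mod_cast hM)
  have hℓ0 : 0 ≤ ℓ := (Real.log_nonneg <| (one_le_div hδ).2 (by linarith)).trans hℓ
  have hlog := log_add_log_mul_succ_div_le hc (by omega) (by omega : 3 ≤ s) hδ hδ1
  have hs0 : (0 : ℝ) < s := by linarith
  rw [← Real.sqrt_sq (by linarith : 0 ≤ C), ← Real.sqrt_mul (sq_nonneg C)]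
  refine Real.sqrt_le_sqrt ?_
  calc (Λ + Real.log c + Real.log ((s + 1) * (s + 2) / δ)) / (2 * s)
      ≤ (C ^ 2 * φ + 4 * Real.log (s / δ)) / (2 * s) :=
        div_le_div_of_nonneg_right (by linarith) (by positivity)
    _ = C ^ 2 * φ / (2 * s) + 2 * (Real.log (s / δ) / s) := by
        field_simp
        ring
    _ ≤ C ^ 2 * φ / M + C ^ 2 * (ℓ / M) := by
        have hC2 : 2 ≤ C ^ 2 := by nlinarith
        have hℓM : Real.log (s / δ) / s ≤ ℓ / M :=
          (log_div_div_le hM3 hMs' hδ hδ1).trans (by gcongr)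
        have : 0 ≤ ℓ / M := by positivity
        refine add_le_add (by gcongr; linarith) ?_
        calc 2 * (Real.log (s / δ) / s) ≤ 2 * (ℓ / M) := by gcongr
          _ ≤ C ^ 2 * (ℓ / M) := by gcongr
    _ = C ^ 2 * (1 / M * (φ + ℓ)) := by ring
    _ ≤ C ^ 2 * (u / (M - 8 * c) * (φ + ℓ)) := by
        gcongr
        linarith

lemma sqrt_le_max_one_mul_sqrt {u d Φ ℓ : ℝ} (hu : 0 ≤ u) (hd : 0 ≤ d) (hΦ : 0 ≤ Φ) (hℓ : 0 ≤ ℓ)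
    (hγ : 0 < γ) :
    √(u / d * (Φ / γ ^ 2 + ℓ)) ≤ max 1 γ * √(u / (d * γ ^ 2) * (Φ + ℓ)) := by
  have hmax : 0 ≤ max 1 γ := zero_le_one.trans (le_max_left _ _)
  have h1 : 1 ≤ max 1 γ ^ 2 := one_le_pow₀ (le_max_left _ _)
  have hγ2 : γ ^ 2 ≤ max 1 γ ^ 2 := pow_le_pow_left₀ hγ.le (le_max_right _ _) 2
  calc √(u / d * (Φ / γ ^ 2 + ℓ)) = √(u / (d * γ ^ 2) * (1 * Φ + γ ^ 2 * ℓ)) := by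
        congr 1
        field_simp
    _ ≤ √(u / (d * γ ^ 2) * (max 1 γ ^ 2 * Φ + max 1 γ ^ 2 * ℓ)) := by gcongr
    _ = √(max 1 γ ^ 2 * (u / (d * γ ^ 2) * (Φ + ℓ))) := by ring_nf
    _ = max 1 γ * √(u / (d * γ ^ 2) * (Φ + ℓ)) := by
        rw [Real.sqrt_mul (sq_nonneg _), Real.sqrt_sq hmax]

lemma robustBound_of_colNorm_le (hC : 0 ≤ C) (hcol : colNorm (trueConfusion (net W)
      (advMeasure A D)) ≤ ν * specNorm (marginConfusion γ (net W) (advSample A S))) :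
    RobustBound C ν h B ε δ γ D S W A :=
  ⟨hcol.trans (le_add_of_nonneg_right (by positivity)),
    hcol.trans (le_add_of_nonneg_right (by positivity))⟩

lemma robustBound_of_card_le_one (hk : k n ≤ 1) (hC : 0 ≤ C) (hν : 0 ≤ ν) :
    RobustBound C ν h B ε δ γ D S W A := by
  refine robustBound_of_colNorm_le hC <|
    (colNorm_le le_rfl fun j => le_of_eq (Finset.sum_eq_zero fun i _ => ?_)).trans
      (mul_nonneg hν (specNorm_nonneg _))
  have hij : i = j := Fin.ext (by omega)
  simp [trueConfusion, hij]

lemma FrequencyBound.le_div_add_sqrt {Ω ι : Type*} [MeasurableSpace Ω] {D : Measure Ω}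
    {S : ι → Ω} {L E : Set Ω} {x : ℝ} (hb : FrequencyBound D S L E x) (hL : 0 < sampleCount S L) :
    (cond D L).real E ≤
      sampleCount S (L ∩ E) / sampleCount S L + √(x / (2 * sampleCount S L)) := by
  have hN : (0 : ℝ) < sampleCount S L := by exact_mod_cast hL
  have hsqrt : √(sampleCount S L * x / 2) / sampleCount S L = √(x / (2 * sampleCount S L)) := by
    nth_rewrite 2 [← Real.sqrt_sq hN.le]
    rw [← Real.sqrt_div' _ (sq_nonneg _)]
    congr 1
    field_simp
  rw [← hsqrt, ← add_div, le_div_iff₀' hN]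
  exact hb

lemma robustBound_of_frequencyBound [Nontrivial (Fin (k n))] (hn : 0 < n) (hδ : 0 < δ)
    (hδ1 : δ ≤ 1) (hγ : 0 < γ) (hS : 8 * k n < minClassCount S) (hA : Measurable A) (hC : 2 ≤ C)
    {Λ : ℝ} (hΛ : Λ ≤ C ^ 2 * (complexity h B ε W / γ ^ 2))
    {E : Fin (k n) → Set (EuclideanSpace ℝ (Fin (k 0)) × Fin (k n))}
    (htrue : ∀ j, ∀ᵐ p ∂D, margin (net W (A p)) j ≤ 0 → p ∈ E j)
    (hemp : ∀ q, S q ∈ E (S q).2 → margin (net W (A (S q))) (S q).2 ≤ γ)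
    (hfreq : ∀ j, FrequencyBound D S {p | p.2 = j} (E j) (Λ + Real.log (k n) +
      Real.log ((classCount S j + 1) * (classCount S j + 2) / δ))) :
    RobustBound C √(k n) h B ε δ γ D S W A := by
  have hΦ := complexity_nonneg h B ε W
  have hk : 1 ≤ k n := by
    have := Fin.nontrivial_iff_two_le.1 ‹_›
    omega
  have hk' : (1 : ℝ) ≤ k n := by exact_mod_cast hk
  have hn' : (1 : ℝ) ≤ n := by exact_mod_cast hn
  have hM : (0 : ℝ) < minClassCount S := by exact_mod_cast (by omega : 0 < minClassCount S)
  have hcM : (0 : ℝ) ≤ minClassCount S - 8 * k n := sub_nonneg.2 (by exact_mod_cast hS.le)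
  have hlog : Real.log (minClassCount S / δ) ≤ Real.log (n * minClassCount S / δ) := by
    gcongr
    exact le_mul_of_one_le_left hM.le hn'
  have hlog0 : 0 ≤ Real.log (n * minClassCount S / δ) :=
    (Real.log_nonneg ((one_le_div hδ).2 (hδ1.trans (by
      exact_mod_cast (by omega : 1 ≤ minClassCount S))))).trans hlog
  have hfirst := colNorm_trueConfusion_le (continuous_net W).measurable hA
    (τ := C * √(√(k n) ^ 2 * k n / ((minClassCount S : ℝ) - 8 * k n) *
          (complexity h B ε W / γ ^ 2 + Real.log (n * minClassCount S / δ))))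
    (by positivity) htrue hemp fun j => by
      have hMj : minClassCount S ≤ classCount S j := ciInf_le' _ j
      have hj := (hfreq j).le_div_add_sqrt (by rw [sampleCount_label]; omega)
      rw [sampleCount_label] at hj
      refine hj.trans (add_le_add_right (sqrt_deviation_le (by omega) hS hMj hδ hδ1 hC ?_
        (by positivity) hΛ hlog) _)
      rw [Real.sq_sqrt (Nat.cast_nonneg _)]
      exact one_le_mul_of_one_le_of_one_le hk' hk'
  refine ⟨hfirst, hfirst.trans (add_le_add_right ?_ _)⟩
  rw [mul_assoc]
  gcongr
  exact sqrt_le_max_one_mul_sqrt (by positivity) hcM hΦ hlog0 hγ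

lemma measure_not_forall_frequencyBound_label_le {X κ : Type*} [MeasurableSpace X] [Countable κ]
    {c : ℕ} (D : Measure (X × Fin c)) [IsProbabilityMeasure D] {Λ : κ → ℝ} (hΛ : IsCodeLength Λ)
    {E : κ → Fin c → Set (X × Fin c)} (hE : ∀ i j, MeasurableSet (E i j)) (hδ : 0 < δ) :
    (Measure.pi fun _ : Fin m => D) {S | ¬ ∀ i j, FrequencyBound D S {p | p.2 = j} (E i j)
      (Λ i + Real.log c + Real.log ((classCount S j + 1) * (classCount S j + 2) / δ))} ≤
      ENNReal.ofReal δ := by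
  have hcode := hΛ.sigma fun _ => isCodeLength_log_card (κ := Fin c)
  simpa only [sampleCount_label, Nat.card_fin, Sigma.forall] using
    measure_not_forall_frequencyBound_le (ι := Fin m) D hcode (L := fun i => {p | p.2 = i.2})
      (fun i => measurableSet_label i.2) (fun i => hE i.1 i.2) hδ

theorem measure_not_robustBound_le [Nontrivial (Fin (k n))] [IsProbabilityMeasure D] (hn : 0 < n)
    (hδ : 0 < δ) (hδ1 : δ ≤ 1) (hγ : 0 < γ) (hA : Measurable A) (hC : 2 ≤ C) :
    (Measure.pi fun _ : Fin m => D)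
      {S | ¬ (8 * k n < minClassCount S → RobustBound C √(k n) h B ε δ γ D S W A)} ≤
      ENNReal.ofReal δ := by
  set E : Fin (k n) → Set (EuclideanSpace ℝ (Fin (k 0)) × Fin (k n)) :=
    fun j => {p | margin (net W (A p)) j ≤ 0}
  have hE (j) : MeasurableSet (E j) :=
    measurableSet_le ((lipschitzWith_margin j).continuous.measurable.comp
      ((continuous_net W).measurable.comp hA)) measurable_const
  refine (measure_mono ?_).trans (measure_not_forall_frequencyBound_label_le D
    (isCodeLength_log_card (κ := Unit)) (E := fun _ => E) (fun _ => hE) hδ)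
  refine fun S hS hfreq => hS fun hmin => ?_
  refine robustBound_of_frequencyBound hn hδ hδ1 hγ hmin hA hC ?_
    (fun j => ae_of_all _ fun p hp => hp) (fun q hq => le_trans hq hγ.le) (hfreq ())
  have hΦ := complexity_nonneg h B ε W
  simpa using by positivity

end RobustBounds

/-! ### The length of network codes -/

section NetCodeLength

variable {n h : ℕ} {k : ℕ → ℕ}

/-- The length of a network code: the resolution, the ranks and the matrices are encoded one after
the other. -/
def NetCode.length (c : NetCode n k h) : ℝ :=
  Real.log ((c.1 + 1) * (c.1 + 2)) + (Real.log (Nat.card (Fin n → Fin (h + 1))) +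
    Real.log (Nat.card ((l : Fin n) →
      MatrixCode (Fin (k (l + 1))) (Fin (k l)) (8 * n * (c.1 + 1) * h ^ 2) (c.2.1 l))))

lemma isCodeLength_netCodeLength : IsCodeLength (NetCode.length : NetCode n k h → ℝ) :=
  isCodeLength_nat.sigma fun _ => isCodeLength_log_card.sigma fun _ => isCodeLength_log_card

lemma half_le_log_mul (hn : 0 < n) (hh : 2 ≤ h) : 1 / 2 ≤ Real.log (n * h) := by
  have hnh : (2 : ℝ) ≤ n * h := by exact_mod_cast hh.trans (Nat.le_mul_of_pos_left h hn)
  linarith [Real.log_two_gt_d9, Real.log_le_log two_pos hnh]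

lemma log_le_log_natCast_mul (hn : 0 < n) (hh : 2 ≤ h) : Real.log h ≤ Real.log (n * h) :=
  Real.log_le_log (by exact_mod_cast (by omega : 0 < h)) <|
    le_mul_of_one_le_left (Nat.cast_nonneg _) (by exact_mod_cast hn)

lemma log_grid_le {b : ℕ} (hn : 0 < n) (hh : 2 ≤ h) (hb : 0 < b) :
    Real.log ((2 * (8 * n * b * h ^ 2) + 1 : ℕ)) ≤ 7 * Real.log (n * h) + Real.log b := by
  have hnh : 2 ≤ n * h := hh.trans (Nat.le_mul_of_pos_left h hn)
  have hnat : 2 * (8 * n * b * h ^ 2) + 1 ≤ (n * h) ^ 7 * b := by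
    have hpos : 1 ≤ n * h ^ 2 * b := Nat.mul_pos (by positivity) hb
    calc 2 * (8 * n * b * h ^ 2) + 1 ≤ 2 ^ 5 * (n * h ^ 2 * b) := by linarith
      _ ≤ (n * h) ^ 5 * (n ^ 2 * h ^ 2 * b) := by
          gcongr
          exact Nat.le_self_pow two_ne_zero n
      _ = (n * h) ^ 7 * b := by ring
  calc Real.log ((2 * (8 * n * b * h ^ 2) + 1 : ℕ)) ≤ Real.log (((n * h) ^ 7 * b : ℕ) : ℝ) :=
        Real.log_le_log (by positivity) (by exact_mod_cast hnat)
    _ = 7 * Real.log (n * h) + Real.log b := by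
        push_cast
        rw [Real.log_mul (by positivity) (by positivity), Real.log_pow, Nat.cast_ofNat]

-- If `b > h`, then `t * log b ≤ b ^ 2`, as the rank `t` is at most the width `h`.
lemma rank_mul_log_le {t b : ℕ} {X H : ℝ} (hH : 1 / 2 ≤ H) (hhH : Real.log h ≤ H) (hb : 0 < b)
    (hbX : (b : ℝ) ^ 2 ≤ X) (ht : t ≤ h) (htX : t ≤ 17 * X) : t * Real.log b ≤ 17 * X * H := by
  have hX : 0 ≤ X := (sq_nonneg _).trans hbX
  rcases le_total b h with hbh | hhb
  · have hlog : Real.log b ≤ H :=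
      (Real.log_le_log (by exact_mod_cast hb) (by exact_mod_cast hbh)).trans hhH
    gcongr
  · calc t * Real.log b ≤ b * b := by
          gcongr
          · exact ht.trans hhb
          · exact Real.log_le_self (Nat.cast_nonneg b)
      _ ≤ X := by rwa [← sq]
      _ ≤ 17 * X * H := by nlinarith

lemma log_card_matrixCodes_le (hk : ∀ l ≤ n, k l ≤ h) (N : ℕ) (t : Fin n → ℕ) :
    Real.log (Nat.card ((l : Fin n) → MatrixCode (Fin (k (l + 1))) (Fin (k l)) N (t l))) ≤
      2 * h * ∑ l, t l * Real.log ((2 * N + 1 : ℕ)) := by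
  rw [Nat.card_pi, Nat.cast_prod, Real.log_prod fun l _ => by
    rw [card_matrixCode]
    positivity, Finset.mul_sum]
  refine Finset.sum_le_sum fun l _ => ?_
  have hwidth : ((k (l + 1) + k l : ℕ) : ℝ) ≤ 2 * h := by
    have hin := hk l l.2.le
    have hout := hk (l + 1) l.2
    exact_mod_cast (by omega : k (l + 1) + k l ≤ 2 * h)
  rw [card_matrixCode, Fintype.card_fin, Fintype.card_fin, Nat.cast_pow, Real.log_pow,
    Nat.cast_mul, mul_assoc]
  gcongr

lemma log_mul_succ_le {b : ℕ} (hb : 0 < b) : Real.log (b * (b + 1)) ≤ 2 * b := by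
  have hb' : (0 : ℝ) < b := by exact_mod_cast hb
  rw [Real.log_mul (by positivity) (by positivity)]
  linarith [Real.log_le_sub_one_of_pos hb', Real.log_le_sub_one_of_pos (add_pos hb' one_pos)]

lemma log_card_ranks_le (hn : 0 < n) (hh : 2 ≤ h) :
    Real.log (Nat.card (Fin n → Fin (h + 1))) ≤ 2 * n * Real.log (n * h) := by
  have hsucc : Real.log ((h + 1 : ℕ)) ≤ 2 * Real.log (n * h) := by
    calc Real.log ((h + 1 : ℕ)) ≤ Real.log ((h ^ 2 : ℕ) : ℝ) :=
          Real.log_le_log (by positivity) (by exact_mod_cast (by nlinarith : h + 1 ≤ h ^ 2))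
      _ = 2 * Real.log h := by rw [Nat.cast_pow, Real.log_pow, Nat.cast_ofNat]
      _ ≤ 2 * Real.log (n * h) :=
          mul_le_mul_of_nonneg_left (log_le_log_natCast_mul hn hh) two_pos.le
  rw [Nat.card_fun, Nat.card_fin, Nat.card_fin, Nat.cast_pow, Real.log_pow]
  nlinarith [Nat.cast_nonneg (α := ℝ) n]

lemma rank_mul_log_grid_le {t b : ℕ} {r : ℝ} (hn : 0 < n) (hh : 2 ≤ h) (hb : 0 < b) (hr : 1 ≤ r)
    (ht : t ≤ h) (htr : t ≤ 16 * n ^ 2 * b ^ 2 * r + 1) :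
    t * Real.log ((2 * (8 * n * b * h ^ 2) + 1 : ℕ)) ≤
      136 * (n ^ 2 * b ^ 2 * r) * Real.log (n * h) := by
  have hn1 : (1 : ℝ) ≤ n := by exact_mod_cast hn
  have hb1 : (1 : ℝ) ≤ b := by exact_mod_cast hb
  have hH : 1 / 2 ≤ Real.log (n * h) := half_le_log_mul hn hh
  have hbX : (b : ℝ) ^ 2 ≤ n ^ 2 * b ^ 2 * r := by
    calc (b : ℝ) ^ 2 = 1 * b ^ 2 * 1 := by ring
      _ ≤ n ^ 2 * b ^ 2 * r := by gcongr; exact one_le_pow₀ hn1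
  have htX : (t : ℝ) ≤ 17 * (n ^ 2 * b ^ 2 * r) := by linarith [one_le_pow₀ hb1 (n := 2)]
  calc t * Real.log ((2 * (8 * n * b * h ^ 2) + 1 : ℕ))
      ≤ t * (7 * Real.log (n * h) + Real.log b) := by
        gcongr
        exact log_grid_le hn hh hb
    _ = t * (7 * Real.log (n * h)) + t * Real.log b := mul_add _ _ _
    _ ≤ 17 * (n ^ 2 * b ^ 2 * r) * (7 * Real.log (n * h)) +
          17 * (n ^ 2 * b ^ 2 * r) * Real.log (n * h) :=
        add_le_add (mul_le_mul_of_nonneg_right htX (by linarith))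
          (rank_mul_log_le hH (log_le_log_natCast_mul hn hh) hb hbX ht htX)
    _ = 136 * (n ^ 2 * b ^ 2 * r) * Real.log (n * h) := by ring

section Complexity

variable {r : Fin n → ℝ} {b : ℕ}

lemma natCast_le_sum_of_one_le (hr : ∀ l, 1 ≤ r l) : (n : ℝ) ≤ ∑ l, r l := by
  simpa using Finset.sum_le_sum fun l (_ : l ∈ Finset.univ) => hr l

lemma log_mul_succ_le_complexity (hn : 0 < n) (hh : 2 ≤ h) (hb : 0 < b) (hr : ∀ l, 1 ≤ r l) :
    Real.log (b * (b + 1)) ≤ 4 * (b ^ 2 * n ^ 2 * h * Real.log (n * h) * ∑ l, r l) := by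
  have hb1 : (1 : ℝ) ≤ b := by exact_mod_cast hb
  have hn1 : (1 : ℝ) ≤ n := by exact_mod_cast hn
  have hh1 : (1 : ℝ) ≤ h := by exact_mod_cast one_le_two.trans hh
  have hlog : 1 / 2 ≤ Real.log (n * h) := half_le_log_mul hn hh
  calc Real.log (b * (b + 1)) ≤ 2 * b := log_mul_succ_le hb
    _ = 4 * ((b : ℝ) * 1 * 1 * (1 / 2) * 1) := by ring
    _ ≤ 4 * (b ^ 2 * n ^ 2 * h * Real.log (n * h) * ∑ l, r l) := by
        gcongr
        exacts [le_self_pow₀ hb1 two_ne_zero, one_le_pow₀ hn1,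
          hn1.trans (natCast_le_sum_of_one_le hr)]

lemma log_card_ranks_le_complexity (hn : 0 < n) (hh : 2 ≤ h) (hb : 0 < b) (hr : ∀ l, 1 ≤ r l) :
    Real.log (Nat.card (Fin n → Fin (h + 1))) ≤
      2 * (b ^ 2 * n ^ 2 * h * Real.log (n * h) * ∑ l, r l) := by
  have hb1 : (1 : ℝ) ≤ b := by exact_mod_cast hb
  have hn1 : (1 : ℝ) ≤ n := by exact_mod_cast hn
  have hh1 : (1 : ℝ) ≤ h := by exact_mod_cast one_le_two.trans hh
  have hlog : 1 / 2 ≤ Real.log (n * h) := half_le_log_mul hn hh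
  calc Real.log (Nat.card (Fin n → Fin (h + 1))) ≤ 2 * n * Real.log (n * h) :=
        log_card_ranks_le hn hh
    _ = 2 * (1 * 1 * 1 * Real.log (n * h) * n) := by ring
    _ ≤ 2 * (b ^ 2 * n ^ 2 * h * Real.log (n * h) * ∑ l, r l) := by
        gcongr
        exacts [one_le_pow₀ hb1, one_le_pow₀ hn1, natCast_le_sum_of_one_le hr]

lemma log_card_matrixCodes_le_complexity (hk : ∀ l ≤ n, k l ≤ h) (hn : 0 < n) (hh : 2 ≤ h)
    (hb : 0 < b) (hr : ∀ l, 1 ≤ r l) {t : Fin n → ℕ} (ht : ∀ l, t l ≤ h)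
    (htr : ∀ l, t l ≤ 16 * n ^ 2 * b ^ 2 * r l + 1) :
    Real.log (Nat.card ((l : Fin n) →
        MatrixCode (Fin (k (l + 1))) (Fin (k l)) (8 * n * b * h ^ 2) (t l))) ≤
      272 * (b ^ 2 * n ^ 2 * h * Real.log (n * h) * ∑ l, r l) := by
  calc Real.log (Nat.card ((l : Fin n) →
        MatrixCode (Fin (k (l + 1))) (Fin (k l)) (8 * n * b * h ^ 2) (t l)))
      ≤ 2 * h * ∑ l, t l * Real.log ((2 * (8 * n * b * h ^ 2) + 1 : ℕ)) :=
        log_card_matrixCodes_le hk _ t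
    _ ≤ 2 * h * ∑ l, 136 * (n ^ 2 * b ^ 2 * r l) * Real.log (n * h) := by
        refine mul_le_mul_of_nonneg_left (Finset.sum_le_sum fun l _ => ?_) (by positivity)
        exact rank_mul_log_grid_le hn hh hb (hr l) (ht l) (htr l)
    _ = 272 * (b ^ 2 * n ^ 2 * h * Real.log (n * h) * ∑ l, r l) := by
        rw [← Finset.sum_mul, ← Finset.mul_sum, ← Finset.mul_sum]
        ring

end Complexity

lemma NetCode.length_le (hk : ∀ l ≤ n, k l ≤ h) (hn : 0 < n) (hh : 2 ≤ h) (c : NetCode n k h)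
    {r : Fin n → ℝ} (hr : ∀ l, 1 ≤ r l)
    (htr : ∀ l, ((c.2.1 l : ℕ) : ℝ) ≤ 16 * n ^ 2 * (c.1 + 1) ^ 2 * r l + 1) :
    c.length ≤ 278 * ((c.1 + 1) ^ 2 * n ^ 2 * h * Real.log (n * h) * ∑ l, r l) := by
  have hscale := log_mul_succ_le_complexity hn hh c.1.succ_pos hr
  have hranks := log_card_ranks_le_complexity hn hh c.1.succ_pos hr
  have hmatrices := log_card_matrixCodes_le_complexity hk hn hh c.1.succ_pos hr
    (fun l => Nat.lt_succ_iff.1 (c.2.1 l).2) (by simpa using htr)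
  rw [Nat.cast_succ, add_assoc, one_add_one_eq_two] at hscale
  rw [Nat.cast_succ] at hranks hmatrices
  rw [NetCode.length]
  linarith

end NetCodeLength

/-! ### Transfer of margins through the attack -/

section Transfer

open WithLp (toLp)

/-- The points with a perturbation of norm at most `ε` that has margin at most `θ`. The closed
thickening makes the set closed, hence measurable. -/
def vulnerableSet {d c : ℕ} (ε θ : ℝ) (g : EuclideanSpace ℝ (Fin d) → Fin c → ℝ) (j : Fin c) :
    Set (EuclideanSpace ℝ (Fin d)) :=
  Metric.cthickening ε {x | margin (g x) j ≤ θ}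

variable {d c : ℕ} {ε θ e B : ℝ} {f g : EuclideanSpace ℝ (Fin d) → Fin c → ℝ} {j : Fin c}
  {x x' : EuclideanSpace ℝ (Fin d)}

lemma isClosed_vulnerableSet : IsClosed (vulnerableSet ε θ g j) := Metric.isClosed_cthickening

lemma mem_vulnerableSet (hg : Continuous g) (hε : 0 ≤ ε) :
    x ∈ vulnerableSet ε θ g j ↔ ∃ x', ‖x' - x‖ ≤ ε ∧ margin (g x') j ≤ θ := by
  have hclosed : IsClosed {x | margin (g x) j ≤ θ} :=
    isClosed_le ((lipschitzWith_margin j).continuous.comp hg) continuous_const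
  rw [vulnerableSet, hclosed.cthickening_eq_biUnion_closedBall hε]
  simp [dist_eq_norm', and_comm]

lemma mem_vulnerableSet_of_margin_le (hg : Continuous g) (hε : 0 ≤ ε)
    (hfg : ∀ x, ‖x‖ ≤ B + ε → ‖toLp 2 (g x - f x)‖ ≤ e) (hx : ‖x‖ ≤ B) (hx' : ‖x' - x‖ ≤ ε)
    (hf : margin (f x') j ≤ θ) : x ∈ vulnerableSet ε (θ + 2 * e) g j :=
  (mem_vulnerableSet hg hε).2 ⟨x', hx', (margin_le_of_norm_sub_le j <| hfg x' <| by
    linarith [norm_le_norm_add_norm_sub' x' x]).trans (by gcongr)⟩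

lemma IsAttack.margin_le_of_mem_vulnerableSet {ℓ : (Fin c → ℝ) → Fin c → ℝ}
    {A : EuclideanSpace ℝ (Fin d) × Fin c → EuclideanSpace ℝ (Fin d)} (hA : IsAttack B ε ℓ f A)
    (hℓ : IsMarginLoss ℓ) (hg : Continuous g) (hε : 0 ≤ ε)
    (hfg : ∀ x, ‖x‖ ≤ B + ε → ‖toLp 2 (g x - f x)‖ ≤ e) (hx : ‖x‖ ≤ B)
    (h : x ∈ vulnerableSet ε θ g j) : margin (f (A (x, j))) j ≤ θ + 2 * e := by
  obtain ⟨x', hx', hθ⟩ := (mem_vulnerableSet hg hε).1 h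
  have hclose : ‖toLp 2 (f x' - g x')‖ ≤ e := by
    rw [← neg_sub, WithLp.toLp_neg, norm_neg]
    exact hfg x' (by linarith [norm_le_norm_add_norm_sub' x' x])
  calc margin (f (A (x, j))) j ≤ margin (f x') j := hA.margin_le hℓ hx hx'
    _ ≤ margin (g x') j + 2 * e := margin_le_of_norm_sub_le j hclose
    _ ≤ θ + 2 * e := by gcongr

end Transfer

/-! ### All networks at once -/

section AllNetworks

variable {n m h : ℕ} {k : ℕ → ℕ} {B ε δ γ : ℝ}

lemma one_le_frobSq_div_specNorm_sq {p q : ℕ} {M : Matrix (Fin p) (Fin q) ℝ} (hM : specNorm M ≠ 0) :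
    1 ≤ frobSq M / specNorm M ^ 2 :=
  (one_le_div (by positivity)).2 (l2_opNorm_sq_le_sum_sq M)

lemma exists_netCode_length_le (hk : ∀ l ≤ n, k l ≤ h) (hn : 0 < n) (hh : 2 ≤ h) {W : Weights n k}
    (hR : 0 < B + ε) (hγ : 0 < γ) (hW : γ / 2 < (∏ l, specNorm (W l)) * (B + ε)) :
    ∃ c : NetCode n k h, c.length ≤ 200 ^ 2 * (complexity h B ε W / γ ^ 2) ∧
      ∀ x, ‖x‖ ≤ B + ε → ‖WithLp.toLp 2 (c.scores (B + ε) γ x - net W x)‖ ≤ γ / 4 := by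
  have hW0 (l) : specNorm (W l) ≠ 0 := fun hl => by
    rw [Finset.prod_eq_zero (Finset.mem_univ l) hl, zero_mul] at hW
    linarith
  obtain ⟨c, hscale, hranks, happrox⟩ :=
    exists_netCode_norm_scores_sub_le hk (by omega) hn hW0 hR hγ
  refine ⟨c, ?_, happrox⟩
  set K := (B + ε) * (∏ l, specNorm (W l)) / γ
  have hK : 1 / 2 < K := by
    rw [lt_div_iff₀ hγ]
    linarith
  have hcK : (c.1 + 1 : ℝ) ≤ 10 * K := by
    linarith [show (c.1 : ℝ) < 8 * K from hscale]
  have hsum : 0 ≤ ∑ l, frobSq (W l) / specNorm (W l) ^ 2 :=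
    Finset.sum_nonneg fun l _ => zero_le_one.trans (one_le_frobSq_div_specNorm_sq (hW0 l))
  have hlog : 0 ≤ Real.log (n * h) := by exact_mod_cast Real.log_natCast_nonneg (n * h)
  calc c.length ≤ 278 * ((c.1 + 1) ^ 2 * n ^ 2 * h * Real.log (n * h) *
          ∑ l, frobSq (W l) / specNorm (W l) ^ 2) :=
        c.length_le hk hn hh (fun l => one_le_frobSq_div_specNorm_sq (hW0 l)) hranks
    _ ≤ 278 * ((10 * K) ^ 2 * n ^ 2 * h * Real.log (n * h) *
          ∑ l, frobSq (W l) / specNorm (W l) ^ 2) := by gcongr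
    _ = 27800 * (complexity h B ε W / γ ^ 2) := by
        rw [complexity, Finset.prod_pow]
        ring
    _ ≤ 200 ^ 2 * (complexity h B ε W / γ ^ 2) := by
        have := complexity_nonneg h B ε W
        gcongr
        norm_num

variable {D : Measure (EuclideanSpace ℝ (Fin (k 0)) × Fin (k n))}
  {S : Fin m → EuclideanSpace ℝ (Fin (k 0)) × Fin (k n)} {W : Weights n k}
  {A : EuclideanSpace ℝ (Fin (k 0)) × Fin (k n) → EuclideanSpace ℝ (Fin (k 0))}
  {ℓ : (Fin (k n) → ℝ) → Fin (k n) → ℝ}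

lemma margin_net_le (x : EuclideanSpace ℝ (Fin (k 0))) (j : Fin (k n)) :
    margin (net W x) j ≤ 2 * ((∏ l, specNorm (W l)) * ‖x‖) := by
  have hzero : margin (0 : Fin (k n) → ℝ) j = 0 := by simp [margin]
  have hnorm : ‖WithLp.toLp 2 (net W x - 0)‖ ≤ (∏ l, specNorm (W l)) * ‖x‖ := by
    rw [sub_zero]
    exact norm_net_le W x
  linarith [margin_le_of_norm_sub_le j hnorm]

-- All the adversarial examples have margin at most `γ`, so the empirical confusion matrix counts
-- the whole sample.
lemma robustBound_of_prod_specNorm_le [Nontrivial (Fin (k n))] {C : ℝ} (hC : 0 ≤ C)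
    (hS : 8 * k n < minClassCount S) (hSB : ∀ q, ‖(S q).1‖ ≤ B) (hA : IsAttack B ε ℓ (net W) A)
    (hW : (∏ l, specNorm (W l)) * (B + ε) ≤ γ / 2) :
    RobustBound C √(k n) h B ε δ γ D S W A := by
  refine robustBound_of_colNorm_le hC ?_
  rw [← add_zero (√(k n) * _)]
  refine colNorm_trueConfusion_le (E := fun _ => Set.univ) (continuous_net W).measurable
    hA.measurable le_rfl (by simp) (fun q _ => ?_) fun j => ?_
  · have hAq : ‖A (S q)‖ ≤ B + ε := by
      linarith [norm_le_norm_add_norm_sub' (A (S q)) (S q).1, hSB q,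
        hA.mem_ball (S q).1 (S q).2 (hSB q)]
    calc margin (net W (A (S q))) (S q).2 ≤ 2 * ((∏ l, specNorm (W l)) * ‖A (S q)‖) :=
          margin_net_le _ _
      _ ≤ 2 * ((∏ l, specNorm (W l)) * (B + ε)) := by
          gcongr
          exact Finset.prod_nonneg fun l _ => specNorm_nonneg _
      _ ≤ γ := by linarith
  · have hpos : classCount S j ≠ 0 := by
      have hle : minClassCount S ≤ classCount S j := ciInf_le (OrderBot.bddBelow _) j
      omega
    rw [Set.inter_univ, sampleCount_label, div_self (Nat.cast_ne_zero.2 hpos), add_zero]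
    exact measureReal_le_one

lemma robustBound_of_forall_frequencyBound [Nontrivial (Fin (k n))] (hk : ∀ l ≤ n, k l ≤ h)
    (hn : 0 < n) (hB : 0 < B) (hε : 0 < ε) (hδ : 0 < δ) (hδ1 : δ ≤ 1) (hγ : 0 < γ)
    (hD : ∀ᵐ p ∂D, ‖p.1‖ ≤ B) (hS : 8 * k n < minClassCount S) (hSB : ∀ q, ‖(S q).1‖ ≤ B)
    (hfreq : ∀ (c : NetCode n k h) j, FrequencyBound D S {p | p.2 = j}
      {p | p.1 ∈ vulnerableSet ε (γ / 2) (c.scores (B + ε) γ) j} (c.length + Real.log (k n) +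
        Real.log ((classCount S j + 1) * (classCount S j + 2) / δ)))
    (hℓ : IsMarginLoss ℓ) (hA : IsAttack B ε ℓ (net W) A) :
    RobustBound 200 √(k n) h B ε δ γ D S W A := by
  rcases le_or_gt ((∏ l, specNorm (W l)) * (B + ε)) (γ / 2) with hW | hW
  · exact robustBound_of_prod_specNorm_le (by norm_num) hS hSB hA hW
  have hh : 2 ≤ h := (Fin.nontrivial_iff_two_le.1 ‹_›).trans (hk n le_rfl)
  obtain ⟨c, hlength, happrox⟩ := exists_netCode_length_le hk hn hh (by positivity) hγ hW
  have hscores := c.continuous_scores (B + ε) γ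
  refine robustBound_of_frequencyBound hn hδ hδ1 hγ hS hA.measurable (by norm_num) hlength
    (fun j => ?_) (fun q hq => ?_) (hfreq c)
  · filter_upwards [hD] with p hp hmargin
    have hAp := hA.mem_ball p.1 p.2 hp
    convert mem_vulnerableSet_of_margin_le hscores hε.le happrox hp hAp hmargin using 2
    ring
  · convert hA.margin_le_of_mem_vulnerableSet hℓ hscores hε.le happrox (hSB q) hq using 1
    ring

theorem measure_not_forall_robustBound_le [Nontrivial (Fin (k n))] [IsProbabilityMeasure D]
    (hk : ∀ l ≤ n, k l ≤ h) (hn : 0 < n) (hB : 0 < B) (hε : 0 < ε) (hδ : 0 < δ) (hδ1 : δ ≤ 1)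
    (hγ : 0 < γ) (hD : ∀ᵐ p ∂D, ‖p.1‖ ≤ B) :
    (Measure.pi fun _ : Fin m => D) {S | ¬ (8 * k n < minClassCount S → ∀ ℓ W A, IsMarginLoss ℓ →
      IsAttack B ε ℓ (net W) A → RobustBound 200 √(k n) h B ε δ γ D S W A)} ≤
      ENNReal.ofReal δ := by
  have hSB : ∀ᵐ S ∂Measure.pi fun _ : Fin m => D, ∀ q, ‖(S q).1‖ ≤ B :=
    ae_all_iff.2 fun q => (measurePreserving_eval (fun _ => D) q).quasiMeasurePreserving.ae hD
  refine (measure_mono_ae ?_).trans (measure_not_forall_frequencyBound_label_le D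
    (isCodeLength_netCodeLength (n := n) (k := k) (h := h))
    (E := fun c j => {p | p.1 ∈ vulnerableSet ε (γ / 2) (c.scores (B + ε) γ) j})
    (fun c j => measurable_fst isClosed_vulnerableSet.measurableSet) hδ)
  filter_upwards [hSB] with S hSB hS hfreq
  exact hS fun hmin ℓ W A hℓ hA =>
    robustBound_of_forall_frequencyBound hk hn hB hε hδ hδ1 hγ hD hmin hSB hfreq hℓ hA

end AllNetworks

end RobustConfusion

end

theorem mainTheorem1 :
    ∃ (C : ℝ) (ν : ℕ → ℝ), 0 < C ∧ (∀ c : ℕ, 0 < c → 0 < ν c ∧ ν c ≤ √c) ∧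
      ∀ (n h m : ℕ) (k : ℕ → ℕ) (B ε δ γ : ℝ)
        (D : Measure (EuclideanSpace ℝ (Fin (k 0)) × Fin (k n))) [IsProbabilityMeasure D],
        0 < n → (∀ l ≤ n, k l ≤ h) → 0 < B → 0 < ε → 0 < δ → 0 < γ →
        (∀ᵐ p ∂D, ‖p.1‖ ≤ B) →
        -- any loss, for each network
        (∀ (ℓ : (Fin (k n) → ℝ) → Fin (k n) → ℝ) (W : RobustConfusion.Weights n k)
            (A : EuclideanSpace ℝ (Fin (k 0)) × Fin (k n) → EuclideanSpace ℝ (Fin (k 0))),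
            RobustConfusion.IsAttack B ε ℓ (RobustConfusion.net W) A →
            (Measure.pi fun _ : Fin m => D)
              {S | ¬ (8 * k n < RobustConfusion.minClassCount S →
                RobustConfusion.RobustBound C (ν (k n)) h B ε δ γ D S W A)}
              ≤ ENNReal.ofReal δ) ∧
        -- losses governed by the margin, for all networks at once
        (Measure.pi fun _ : Fin m => D)
          {S | ¬ (8 * k n < RobustConfusion.minClassCount S →
            ∀ (ℓ : (Fin (k n) → ℝ) → Fin (k n) → ℝ) (W : RobustConfusion.Weights n k)
              (A : EuclideanSpace ℝ (Fin (k 0)) × Fin (k n) → EuclideanSpace ℝ (Fin (k 0))),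
              RobustConfusion.IsMarginLoss ℓ →
              RobustConfusion.IsAttack B ε ℓ (RobustConfusion.net W) A →
              RobustConfusion.RobustBound C (ν (k n)) h B ε δ γ D S W A)}
          ≤ ENNReal.ofReal δ := by
  refine ⟨200, fun c => √c, by norm_num, fun c hc => ⟨by positivity, le_rfl⟩, ?_⟩
  intro n h m k B ε δ γ D _ hn hk hB hε hδ hγ hD
  rcases le_or_gt (k n) 1 with hk1 | hk2
  · have hbound := fun (S : Fin m → EuclideanSpace ℝ (Fin (k 0)) × Fin (k n)) W A =>
      RobustConfusion.robustBound_of_card_le_one (C := 200) (ν := √(k n)) (h := h) (B := B)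
        (ε := ε) (δ := δ) (γ := γ) (D := D) (S := S) (W := W) (A := A) hk1 (by norm_num)
        (Real.sqrt_nonneg _)
    simp [hbound]
  rcases le_total δ 1 with hδ1 | hδ1
  · have : Nontrivial (Fin (k n)) := Fin.nontrivial_iff_two_le.2 hk2
    exact ⟨fun ℓ W A hA => RobustConfusion.measure_not_robustBound_le hn hδ hδ1 hγ hA.measurable
      (by norm_num), RobustConfusion.measure_not_forall_robustBound_le hk hn hB hε hδ hδ1 hγ hD⟩
  · have hone : 1 ≤ ENNReal.ofReal δ := ENNReal.one_le_ofReal.2 hδ1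
    exact ⟨fun _ _ _ _ => prob_le_one.trans hone, prob_le_one.trans hone⟩
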